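/- For $n\ge 0$ write $\square^n=\{0,1\}^n$, and let $\square_*$ be the full subcategory of $\mathsf{Set}$ on these sets, with the strict monoidal structure $\square^m\otimes\square^n=\square^{m+n}$. Consider the face maps $\iota^0,\iota^1:\square^0\to\square^1$, the projection $\pi:\square^1\to\square^0$, the connections $\gamma_\wedge,\gamma_\vee:\square^2\to\square^1$ (binary minimum and maximum), the symmetry $\sigma:\square^2\to\square^2$, $(x,y)\mapsto(y,x)$, and the reversal $\rho:\square^1\to\square^1$, $x\mapsto 1-x$. For any subset $S\subseteq\{\gamma_\wedge,\gamma_\vee,\sigma,\rho\}$ let $\square_S$ (a cubical site without diagonals) be the wide monoidal subcategory of $\square_*$ generated by $\iota^0,\iota^1,\pi$ and $S$. Let $(\square_S)_-$ be the monoidal subcategory (containing all objects) generated by $\pi$ and $S$, and let $(\square_S)_+$ be the one generated by $\iota^0,\iota^1$ and $S\cap\{\sigma,\rho\}$. Put $\deg(\square^n)=n$. Definitions. Let $A$ be an essentially small category with a function $\deg:\mathrm{Ob}A\to\mathbb N$ that is invariant under isomorphism, and let $A_-,A_+$ be two classes of morphisms of $A$. - $(A,A_-,A_+)$ is a *generalized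 Reedy category* if $(A_-,A_+)$ is an orthogonal factorization system, every non-isomorphism of $A_-$ strictly lowers degree, and every non-isomorphism of $A_+$ strictly raises degree. - It is an *Eilenberg-Zilber category* if it is a generalized Reedy category and every pair of morphisms of $A_-$ with a common domain has an absolute pushout in $A$, that is, a pushout preserved by every functor out of $A$. - A *pseudo-section* of $p:a\to b$ is a morphism $i:c\to a$ such that $pi$ is an isomorphism. Morphisms $p:a\to b$ and $p':a\to b'$ are *pseudo-equal* if $\phi p=p'$ for some isomorphism $\phi:b\to b'$. A generalized Reedy category is *strongly skeletal* if every morphism of $A_-$ is a split epimorphism and any two morphisms of $A_-$ with the same domain and the same pseudo-sections are pseudo-equal. - A *regular skeletal Reedy category* is a generalized Reedy category such that every morphism of $A_-$ is a split epimorphism, distinct morphisms of $A_-$ have distinct sets of sections, every morphism of $A_+$ is a monomorphism, and $(A,A_-,A_+)$ is a Reedy category in the strict sense (non-identity morphisms of $A_-$ strictly lower degree, non-identity morphisms of $A_+$ strictly raise degree, and every morphism factors uniquely as a morphism of $A_-$ followed by one of $A_+$). **Theorem.** For every $S\subseteq\{\gamma_\wedge,\gamma_\vee,\sigma,\rho\}$,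 $(\square_S,(\square_S)_-,(\square_S)_+)$ with the degree function $\deg$ is a strongly skeletal generalized Reedy category, and it is an Eilenberg-Zilber category. If $\sigma,\rho\notin S$, then it is moreover a regular skeletal Reedy category. -/

import Mathlib

open CategoryTheory

universe w' w v u

namespace CubicalSites

section ReedyTheory

variable {A : Type u} [Category.{v} A]

/-- `(L, R)` is an orthogonal factorization system: both classes contain the isomorphisms and are
closed under composition, every morphism is a morphism of `L` followed by a morphism of `R`,
and `L` has the unique lifting property against `R`. -/
structure IsOrthogonalFactorizationSystem (L R : MorphismProperty A) : Prop where
  iso_left : ∀ ⦃a b : A⦄ (f : a ⟶ b), IsIso f → L f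
  iso_right : ∀ ⦃a b : A⦄ (f : a ⟶ b), IsIso f → R f
  comp_left : ∀ ⦃a b c : A⦄ (f : a ⟶ b) (g : b ⟶ c), L f → L g → L (f ≫ g)
  comp_right : ∀ ⦃a b c : A⦄ (f : a ⟶ b) (g : b ⟶ c), R f → R g → R (f ≫ g)
  factorization : ∀ ⦃a b : A⦄ (f : a ⟶ b),
    ∃ (c : A) (l : a ⟶ c) (r : c ⟶ b), L l ∧ R r ∧ l ≫ r = f
  unique_lift : ∀ ⦃a b c d : A⦄ (l : a ⟶ b) (r : c ⟶ d) (x : a ⟶ c) (y : b ⟶ d),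
    L l → R r → x ≫ r = l ≫ y → ∃! t : b ⟶ c, l ≫ t = x ∧ t ≫ r = y

/-- A generalized Reedy category: an essentially small category with a degree function and
an orthogonal factorization system `(minus, plus)` such that non-isomorphisms of `minus`
strictly lower the degree and non-isomorphisms of `plus` strictly raise it. -/
structure IsGeneralizedReedy (deg : A → ℕ) (minus plus : MorphismProperty A) : Prop
    extends IsOrthogonalFactorizationSystem minus plus where
  essentiallySmall : EssentiallySmall.{v} A
  deg_iso : ∀ ⦃a b : A⦄, Nonempty (a ≅ b) → deg a = deg b
  deg_minus : ∀ ⦃a b : A⦄ (f : a ⟶ b), minus f → ¬ IsIso f → deg b < deg a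
  deg_plus : ∀ ⦃a b : A⦄ (f : a ⟶ b), plus f → ¬ IsIso f → deg a < deg b

/-- The square `f ≫ h = g ≫ k` is an absolute pushout: it is a pushout square, and every functor
carries it to a pushout square. -/
structure IsAbsolutePushout {a b c d : A}
    (f : a ⟶ b) (g : a ⟶ c) (h : b ⟶ d) (k : c ⟶ d) : Prop where
  isPushout : IsPushout f g h k
  map_isPushout : ∀ (B : Type w) [Category.{w'} B] (F : A ⥤ B),
    IsPushout (F.map f) (F.map g) (F.map h) (F.map k)

/-- An Eilenberg-Zilber category: a generalized Reedy category in which every pair of morphisms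
of `minus` with a common domain has an absolute pushout. -/
structure IsEilenbergZilber (deg : A → ℕ) (minus plus : MorphismProperty A) : Prop
    extends IsGeneralizedReedy deg minus plus where
  absolute_pushout : ∀ ⦃a b c : A⦄ (f : a ⟶ b) (g : a ⟶ c), minus f → minus g →
    ∃ (d : A) (h : b ⟶ d) (k : c ⟶ d), IsAbsolutePushout.{w', w} f g h k

/-- `i` is a pseudo-section of `p` if `p ∘ i` is an isomorphism. -/
def IsPseudoSection {a b c : A} (p : a ⟶ b) (i : c ⟶ a) : Prop :=
  IsIso (i ≫ p)

/-- Morphisms with a common domain are pseudo-equal if they differ by an isomorphism of their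
codomains. -/
def PseudoEqual {a b b' : A} (p : a ⟶ b) (p' : a ⟶ b') : Prop :=
  ∃ φ : b ≅ b', p ≫ φ.hom = p'

/-- A strongly skeletal generalized Reedy category. -/
structure IsStronglySkeletal (deg : A → ℕ) (minus plus : MorphismProperty A) : Prop
    extends IsGeneralizedReedy deg minus plus where
  isSplitEpi : ∀ ⦃a b : A⦄ (p : a ⟶ b), minus p → IsSplitEpi p
  pseudoEqual : ∀ ⦃a b b' : A⦄ (p : a ⟶ b) (p' : a ⟶ b'), minus p → minus p' →
    (∀ ⦃c : A⦄ (i : c ⟶ a), IsPseudoSection p i ↔ IsPseudoSection p' i) → PseudoEqual p p'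

/-- A skeletal generalized Reedy category: morphisms of `minus` are split epimorphisms, and
no two distinct ones have the same set of sections. -/
structure IsSkeletal (deg : A → ℕ) (minus plus : MorphismProperty A) : Prop
    extends IsGeneralizedReedy deg minus plus where
  isSplitEpi : ∀ ⦃a b : A⦄ (p : a ⟶ b), minus p → IsSplitEpi p
  eq_of_sections : ∀ ⦃a b : A⦄ (p p' : a ⟶ b), minus p → minus p' →
    (∀ s : b ⟶ a, s ≫ p = 𝟙 b ↔ s ≫ p' = 𝟙 b) → p = p'

/-- `f` is an identity morphism. -/
def IsIdentity {a b : A} (f : a ⟶ b) : Prop :=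
  ∃ h : a = b, f = eqToHom h

/-- A (strict) Reedy category: `minus` and `plus` are wide subcategories, non-identity morphisms
of `minus` strictly lower the degree, non-identity morphisms of `plus` strictly raise it, and
every morphism has exactly one factorization as a morphism of `minus` followed by one
of `plus`. -/
structure IsReedy (deg : A → ℕ) (minus plus : MorphismProperty A) : Prop where
  minus_wide : minus.IsMultiplicative
  plus_wide : plus.IsMultiplicative
  lowers : ∀ ⦃a b : A⦄ (f : a ⟶ b), minus f → ¬ IsIdentity f → deg b < deg a
  raises : ∀ ⦃a b : A⦄ (f : a ⟶ b), plus f → ¬ IsIdentity f → deg a < deg b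
  unique_factorization : ∀ ⦃a b : A⦄ (f : a ⟶ b),
    Nonempty (Unique (MorphismProperty.MapFactorizationData minus plus f))

/-- A regular skeletal Reedy category: a skeletal generalized Reedy category which is a Reedy
category and in which every morphism of `plus` is a monomorphism. -/
structure IsRegularSkeletalReedy (deg : A → ℕ) (minus plus : MorphismProperty A) : Prop
    extends IsSkeletal deg minus plus, IsReedy deg minus plus where
  mono_plus : ∀ ⦃a b : A⦄ (f : a ⟶ b), plus f → Mono f

end ReedyTheory

/-- An object of the full subcategory of sets on the cubes `{0,1}^n`. -/
structure Cube where
  dim : ℕ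

/-- The vertices `{0,1}^n` of the `n`-cube. -/
abbrev Cube.Vertex (a : Cube) : Type := Fin a.dim → Bool

/-- The category of cubes and all maps between their sets of vertices. -/
instance : Category Cube where
  Hom a b := a.Vertex → b.Vertex
  id _ := fun x => x
  comp f g := fun x => g (f x)

/-- The tensor product `{0,1}^m ⊗ {0,1}^n = {0,1}^(m+n)`. -/
def Cube.tensor (a b : Cube) : Cube := ⟨a.dim + b.dim⟩

/-- The tensor product of maps: apply `f` to the first coordinates, `g` to the others, and
concatenate. -/
def Cube.tensorMap {a b a' b' : Cube} (f : a ⟶ b) (g : a' ⟶ b') :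
    a.tensor a' ⟶ b.tensor b' :=
  fun (x : Fin (a.dim + a'.dim) → Bool) =>
    (Fin.append (f fun i => x (Fin.castAdd a'.dim i)) (g fun j => x (Fin.natAdd a.dim j)) :
      Fin (b.dim + b'.dim) → Bool)

/-- The wide monoidal subcategory generated by a class of maps of cubes. Associators and unitors
are identities, up to the equalities of natural numbers between the dimensions. -/
inductive monoidalClosure (G : MorphismProperty Cube) : MorphismProperty Cube
  | of {a b : Cube} (f : a ⟶ b) (hf : G f) : monoidalClosure G f
  | id (a : Cube) : monoidalClosure G (𝟙 a)
  | comp {a b c : Cube} (f : a ⟶ b) (g : b ⟶ c) (hf : monoidalClosure G f)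
      (hg : monoidalClosure G g) : monoidalClosure G (f ≫ g)
  | tensor {a b a' b' : Cube} (f : a ⟶ b) (g : a' ⟶ b') (hf : monoidalClosure G f)
      (hg : monoidalClosure G g) : monoidalClosure G (Cube.tensorMap f g)

instance (G : MorphismProperty Cube) : (monoidalClosure G).IsMultiplicative where
  id_mem a := .id a
  comp_mem f g hf hg := .comp f g hf hg

/-- The fundamental face maps `{0,1}^0 → {0,1}^1`. -/
def faceMap (ε : Bool) : Cube.mk 0 ⟶ Cube.mk 1 := fun _ _ => ε

/-- The fundamental projection map `{0,1}^1 → {0,1}^0`. -/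
def projMap : Cube.mk 1 ⟶ Cube.mk 0 := fun _ i => i.elim0

/-- The connection `(x, y) ↦ x ∧ y`. -/
def meetMap : Cube.mk 2 ⟶ Cube.mk 1 :=
  fun (x : Fin 2 → Bool) (_ : Fin 1) => x 0 && x 1

/-- The connection `(x, y) ↦ x ∨ y`. -/
def joinMap : Cube.mk 2 ⟶ Cube.mk 1 :=
  fun (x : Fin 2 → Bool) (_ : Fin 1) => x 0 || x 1

/-- The fundamental symmetry map `(x, y) ↦ (y, x)`. -/
def symMap : Cube.mk 2 ⟶ Cube.mk 2 := fun (x : Fin 2 → Bool) => ![x 1, x 0]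

/-- The fundamental reversal map `x ↦ 1 - x`. -/
def revMap : Cube.mk 1 ⟶ Cube.mk 1 :=
  fun (x : Fin 1 → Bool) (_ : Fin 1) => !(x 0)

/-- Which optional generators a cubical site without diagonals has. -/
structure Signature where
  hasMeet : Bool
  hasJoin : Bool
  hasSym : Bool
  hasRev : Bool

/-- Generators of the minus class: the projection, and the connections, symmetry and reversal
which are present. -/
inductive Signature.MinusGen (S : Signature) : MorphismProperty Cube
  | proj : S.MinusGen projMap
  | meet (h : S.hasMeet = true) : S.MinusGen meetMap
  | join (h : S.hasJoin = true) : S.MinusGen joinMap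
  | sym (h : S.hasSym = true) : S.MinusGen symMap
  | rev (h : S.hasRev = true) : S.MinusGen revMap

/-- Generators of the plus class: the faces, and the symmetry and reversal which are present. -/
inductive Signature.PlusGen (S : Signature) : MorphismProperty Cube
  | face (ε : Bool) : S.PlusGen (faceMap ε)
  | sym (h : S.hasSym = true) : S.PlusGen symMap
  | rev (h : S.hasRev = true) : S.PlusGen revMap

/-- The cubical site: the wide monoidal subcategory generated by all the generators. -/
abbrev Site (S : Signature) : Type :=
  WideSubcategory (monoidalClosure (S.MinusGen ⊔ S.PlusGen))

namespace Site

variable (S : Signature)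

/-- The degree of the `n`-cube is `n`. -/
def deg (a : Site S) : ℕ := a.obj.dim

/-- The monoidal subcategory generated by projections, connections, symmetries, reversals. -/
def minus : MorphismProperty (Site S) := fun _ _ f => monoidalClosure S.MinusGen f.hom

/-- The monoidal subcategory generated by faces, symmetries, reversals. -/
def plus : MorphismProperty (Site S) := fun _ _ f => monoidalClosure S.PlusGen f.hom

end Site

end CubicalSites

/-! In every morphism of the site each input coordinate influences at most one output coordinate
(`NoDiagonals`). A bijective morphism is therefore a permutation of coordinates followed by
reversals of some of them. Without the symmetry the blocks of influencing inputs stay in order, and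
without the reversal all maps are monotone, so that the permutation, respectively the reversals,
must be trivial. Hence for every signature the isomorphisms are exactly the bijective morphisms, and
they are generated by the symmetries and reversals present (`isoGen_of_bijective`).

Minus maps have sections in the plus class and plus maps have retractions in the minus class. A plus
map is determined up to isomorphism by its image, a subcube, and a subcube of a product is a product
of subcubes. So a plus map can be moved past a minus map one generator at a time, which gives the
factorization. Lifting is formal for split epimorphisms against monomorphisms, and the degree
conditions count vertices.

Strong skeletality is the combinatorial core (`eq_of_bijOn_iff_bijOn`). Pseudo-sections tell which
subcubes a minus map carries bijectively. After composing with an isomorphism, two minus maps with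
the same pseudo-sections share a section whose image is a subcube. Suitable subcubes then show that
corresponding components change along the same edges, so they agree up to negation, and the common
section excludes negation.

The Eilenberg-Zilber property is a formal consequence. Among the factorizations of endomorphisms
equivalent to the identity under `PushoutRel`, choose one through an object of least degree. Its
minus part is unique up to isomorphism, factors through both given maps, and is the diagonal of an
absolute pushout square. If all isomorphisms are identities, strong skeletality becomes regular
skeletality. -/

namespace CubicalSites
-- Formal consequences of strong skeletality.
section Formal

variable {A : Type u} [Category.{v} A]

theorem IsOrthogonalFactorizationSystem.of_splitEpi_of_mono {L R : MorphismProperty A}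
    (iso_left : ∀ ⦃a b : A⦄ (f : a ⟶ b), IsIso f → L f)
    (iso_right : ∀ ⦃a b : A⦄ (f : a ⟶ b), IsIso f → R f)
    (comp_left : ∀ ⦃a b c : A⦄ (f : a ⟶ b) (g : b ⟶ c), L f → L g → L (f ≫ g))
    (comp_right : ∀ ⦃a b c : A⦄ (f : a ⟶ b) (g : b ⟶ c), R f → R g → R (f ≫ g))
    (factorization : ∀ ⦃a b : A⦄ (f : a ⟶ b),
      ∃ (c : A) (l : a ⟶ c) (r : c ⟶ b), L l ∧ R r ∧ l ≫ r = f)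
    (splitEpi : ∀ ⦃a b : A⦄ (f : a ⟶ b), L f → IsSplitEpi f)
    (mono : ∀ ⦃a b : A⦄ (f : a ⟶ b), R f → Mono f) :
    IsOrthogonalFactorizationSystem L R where
  iso_left := iso_left
  iso_right := iso_right
  comp_left := comp_left
  comp_right := comp_right
  factorization := factorization
  unique_lift a b c d l r x y hl hr h := by
    have := splitEpi l hl
    have := mono r hr
    -- A section of `l` supplies the lift; the upper triangle follows by cancelling the monomorphism
    -- `r`.
    have hr' : (section_ l ≫ x) ≫ r = y := by simp [h]
    refine ⟨section_ l ≫ x, ⟨?_, hr'⟩, ?_⟩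
    · rw [← cancel_mono r, h, Category.assoc, hr']
    · rintro t ⟨rfl, -⟩
      simp

/-- Two morphisms into `a` are identified after `f` or after `g`. -/
def CoequalizedBy {a b c : A} (f : a ⟶ b) (g : a ⟶ c) (x : A) (p q : x ⟶ a) : Prop :=
  p ≫ f = q ≫ f ∨ p ≫ g = q ≫ g

/-- Two morphisms into `a` become equal in the pushout of the presheaves represented by the
codomains of the split epimorphisms `f` and `g`. -/
def PushoutRel {a b c : A} (f : a ⟶ b) (g : a ⟶ c) {x : A} (p q : x ⟶ a) : Prop :=
  Relation.EqvGen (CoequalizedBy f g x) p q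

namespace PushoutRel

variable {a b c : A} {f : a ⟶ b} {g : a ⟶ c} {x y : A}

theorem refl (p : x ⟶ a) : PushoutRel f g p p := Relation.EqvGen.refl _

theorem symm {p q : x ⟶ a} (h : PushoutRel f g p q) : PushoutRel f g q p :=
  Relation.EqvGen.symm _ _ h

theorem trans {p q r : x ⟶ a} (h : PushoutRel f g p q) (h' : PushoutRel f g q r) :
    PushoutRel f g p r := Relation.EqvGen.trans _ _ _ h h'

theorem precomp {p q : x ⟶ a} (h : PushoutRel f g p q) (r : y ⟶ x) :
    PushoutRel f g (r ≫ p) (r ≫ q) := by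
  induction h with
  | rel p q h => exact .rel _ _ (h.imp (fun h => by simp [h]) (fun h => by simp [h]))
  | refl p => exact .refl _
  | symm p q _ ih => exact ih.symm
  | trans p q r _ _ ih ih' => exact ih.trans ih'

theorem swap {p q : x ⟶ a} (h : PushoutRel f g p q) : PushoutRel g f p q := by
  induction h with
  | rel p q h => exact .rel _ _ h.symm
  | refl p => exact .refl _
  | symm p q _ ih => exact ih.symm
  | trans p q r _ _ ih ih' => exact ih.trans ih'

/-- The class of a morphism is respected by every cocone under the image of the span, in any
category. This is what makes the pushout below absolute. -/
theorem map_comp_eq {B : Type w} [Category.{w'} B] (F : A ⥤ B) {z : B}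
    {u : F.obj b ⟶ z} {t : F.obj c ⟶ z} (hut : F.map f ≫ u = F.map g ≫ t)
    {p q : x ⟶ a} (h : PushoutRel f g p q) :
    F.map p ≫ F.map f ≫ u = F.map q ≫ F.map f ≫ u := by
  induction h with
  | rel p q h =>
    rcases h with h | h
    · simp only [← Category.assoc, ← F.map_comp, h]
    · rw [hut]
      simp only [← Category.assoc, ← F.map_comp, h]
  | refl p => rfl
  | symm p q _ ih => exact ih.symm
  | trans p q r _ _ ih ih' => exact ih.trans ih'

end PushoutRel

theorem IsGeneralizedReedy.deg_le_of_plus {deg : A → ℕ} {minus plus : MorphismProperty A}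
    (hA : IsGeneralizedReedy deg minus plus) {a b : A} {f : a ⟶ b} (hf : plus f) :
    deg a ≤ deg b := by
  by_cases h : IsIso f
  · exact (hA.deg_iso ⟨asIso f⟩).le
  · exact (hA.deg_plus f hf h).le

namespace IsStronglySkeletal

variable {deg : A → ℕ} {minus plus : MorphismProperty A}
  (hA : IsStronglySkeletal deg minus plus) {a b c : A} {f : a ⟶ b} {g : a ⟶ c}

include hA in
/-- A section of a minimal degeneracy of the class of `𝟙 a` is a pseudo-section of any other
such degeneracy. -/
theorem isPseudoSection_of_minimal {d d' x : A} {m : a ⟶ d} {s : d ⟶ a} {m' : a ⟶ d'}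
    {s' : d' ⟶ a} (hm : minus m) (hs : PushoutRel f g (m ≫ s) (𝟙 a))
    (hs' : PushoutRel f g (m' ≫ s') (𝟙 a))
    (hmin : ∀ (e : A) (n : a ⟶ e) (r : e ⟶ a), minus n → PushoutRel f g (n ≫ r) (𝟙 a) →
      deg d ≤ deg e) (hdeg : deg d = deg d') (i : x ⟶ a) (hi : IsPseudoSection m i) :
    IsPseudoSection m' i := by
  have : IsIso (i ≫ m) := hi
  set t := inv (i ≫ m) ≫ i with ht
  have htm : t ≫ m = 𝟙 d := by simp [ht]
  have hst : PushoutRel f g s t := by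
    have := hs.precomp t
    rwa [← Category.assoc, htm, Category.id_comp, Category.comp_id] at this
  have hs't : PushoutRel f g (t ≫ m' ≫ s') t := by simpa using hs'.precomp t
  -- The composite `m ≫ t ≫ m' ≫ s'` is again equivalent to the identity, so `m ≫ l` competes with
  -- `m`. Minimality makes `l` an isomorphism, and then `deg d = deg d'` makes `r` one.
  obtain ⟨e, l, r, hl, hr, hlr⟩ := hA.factorization (t ≫ m')
  have h1 : PushoutRel f g ((m ≫ l) ≫ r ≫ s') (𝟙 a) := by
    have := ((hs't.trans hst.symm).precomp m).trans hs
    simpa only [← hlr, Category.assoc, ← Category.assoc t] using this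
  have hde : deg d ≤ deg e := hmin e _ _ (hA.comp_left _ _ hm hl) h1
  have hl' : IsIso l := by
    by_contra h
    exact absurd (hA.deg_minus l hl h) (by omega)
  have hr' : IsIso r := by
    by_contra h
    have h1 := hA.deg_plus r hr h
    have h2 := hA.deg_iso ⟨asIso l⟩
    omega
  have h2 : i ≫ m' = (i ≫ m) ≫ (t ≫ m') := by simp [ht]
  unfold IsPseudoSection
  rw [h2, ← hlr]
  infer_instance

include hA in
theorem pseudoEqual_of_minimal {d d' : A} {m : a ⟶ d} {s : d ⟶ a} {m' : a ⟶ d'}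
    {s' : d' ⟶ a} (hm : minus m) (hm' : minus m') (hs : PushoutRel f g (m ≫ s) (𝟙 a))
    (hs' : PushoutRel f g (m' ≫ s') (𝟙 a))
    (hmin : ∀ (e : A) (n : a ⟶ e) (r : e ⟶ a), minus n → PushoutRel f g (n ≫ r) (𝟙 a) →
      deg d ≤ deg e) (hdeg : deg d = deg d') : PseudoEqual m m' :=
  hA.pseudoEqual m m' hm hm' fun _ i =>
    ⟨hA.isPseudoSection_of_minimal hm hs hs' hmin hdeg i,
      hA.isPseudoSection_of_minimal hm' hs' hs (hdeg ▸ hmin) hdeg.symm i⟩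

include hA in
/-- A minimal degeneracy of the class of `𝟙 a` factors through `f`. -/
theorem exists_factor_of_minimal (hf : minus f) {d : A} {m : a ⟶ d} {s : d ⟶ a}
    (hm : minus m) (hs : PushoutRel f g (m ≫ s) (𝟙 a))
    (hmin : ∀ (e : A) (n : a ⟶ e) (r : e ⟶ a), minus n → PushoutRel f g (n ≫ r) (𝟙 a) →
      deg d ≤ deg e) : ∃ h : b ⟶ d, f ≫ h = m := by
  have := hA.isSplitEpi f hf
  obtain ⟨e, l, r, hl, hr, hlr⟩ := hA.factorization (section_ f ≫ m)
  have h1 : PushoutRel f g (f ≫ section_ f) (𝟙 a) := .rel _ _ (Or.inl (by simp))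
  have h2 : PushoutRel f g ((f ≫ l) ≫ r ≫ s) (𝟙 a) := by
    have h3 : (f ≫ l) ≫ r ≫ s = (f ≫ section_ f) ≫ m ≫ s := by
      rw [Category.assoc, ← Category.assoc l, hlr]
      simp only [Category.assoc]
    rw [h3]
    have := hs.precomp (f ≫ section_ f)
    rw [Category.comp_id] at this
    exact this.trans h1
  -- Since `r` cannot lower degree, `f ≫ l` is itself minimal, hence pseudo-equal to `m`.
  have hfl := hA.comp_left _ _ hf hl
  have hde := hmin e _ _ hfl h2
  obtain ⟨φ, hφ⟩ := hA.pseudoEqual_of_minimal hm hfl hs h2 hmin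
    (hde.antisymm (hA.deg_le_of_plus hr))
  exact ⟨l ≫ φ.inv, by rw [← Category.assoc, ← hφ]; simp⟩

include hA in
-- The comparison map out of `F.obj d` is written down using `s`. It is compatible with the cocone
-- because `m ≫ s` is equivalent to the identity, and unique because `F.map m` is split epi.
theorem isPushout_map_of_minimal (hf : minus f) (hg : minus g) {d : A} {m : a ⟶ d} {s : d ⟶ a}
    (hm : minus m) (hs : PushoutRel f g (m ≫ s) (𝟙 a)) {h : b ⟶ d} {k : c ⟶ d}
    (hh : f ≫ h = m) (hk : g ≫ k = m) {B : Type w} [Category.{w'} B] (F : A ⥤ B) :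
    IsPushout (F.map f) (F.map g) (F.map h) (F.map k) := by
  have := hA.isSplitEpi f hf
  have := hA.isSplitEpi g hg
  have := hA.isSplitEpi m hm
  refine ⟨⟨by rw [← F.map_comp, ← F.map_comp, hh, hk]⟩, ⟨?_⟩⟩
  have key : ∀ t : Limits.PushoutCocone (F.map f) (F.map g),
      F.map m ≫ F.map s ≫ F.map f ≫ t.inl = F.map f ≫ t.inl := fun t => by
    have := hs.map_comp_eq F t.condition
    simpa using this
  refine Limits.PushoutCocone.IsColimit.mk _ (fun t => F.map s ≫ F.map f ≫ t.inl) ?_ ?_ ?_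
  · intro t
    rw [← cancel_epi (F.map f), ← Category.assoc, ← F.map_comp, hh]
    exact key t
  · intro t
    rw [← cancel_epi (F.map g), ← Category.assoc, ← F.map_comp, hk, ← t.condition]
    exact key t
  · intro t q hq _
    rw [← cancel_epi (F.map m), key t, ← hq, ← Category.assoc, ← F.map_comp, hh]

include hA in
-- The identity of `a` competes for the least degree, so a minimum exists. The relation is symmetric
-- in `f` and `g`, so the minimal map factors through each of them.
theorem isEilenbergZilber : IsEilenbergZilber.{w', w} deg minus plus where
  toIsGeneralizedReedy := hA.toIsGeneralizedReedy
  absolute_pushout a b c f g hf hg := by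
    classical
    let P : ℕ → Prop := fun n => ∃ (d : A) (m : a ⟶ d) (s : d ⟶ a),
      minus m ∧ PushoutRel f g (m ≫ s) (𝟙 a) ∧ deg d = n
    have hP : ∃ n, P n := ⟨deg a, a, 𝟙 a, 𝟙 a, hA.iso_left _ inferInstance,
      by simpa using PushoutRel.refl _, rfl⟩
    obtain ⟨d, m, s, hm, hs, hd⟩ := Nat.find_spec hP
    have hmin : ∀ (e : A) (n : a ⟶ e) (r : e ⟶ a), minus n →
        PushoutRel f g (n ≫ r) (𝟙 a) → deg d ≤ deg e := fun e n r hn hr =>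
      hd ▸ Nat.find_min' hP ⟨e, n, r, hn, hr, rfl⟩
    obtain ⟨h, hh⟩ := hA.exists_factor_of_minimal hf hm hs hmin
    obtain ⟨k, hk⟩ := hA.exists_factor_of_minimal hg hm hs.swap
      (fun e n r hn hr => hmin e n r hn hr.swap)
    exact ⟨d, h, k, hA.isPushout_map_of_minimal hf hg hm hs hh hk (𝟭 A),
      fun B _ F => hA.isPushout_map_of_minimal hf hg hm hs hh hk F⟩

end IsStronglySkeletal

/-- If all isomorphisms are identities, a strongly skeletal generalized Reedy category whose
plus morphisms are monomorphisms is regular skeletal. -/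
theorem IsStronglySkeletal.isRegularSkeletalReedy {deg : A → ℕ}
    {minus plus : MorphismProperty A} (hA : IsStronglySkeletal deg minus plus)
    (hiso : ∀ ⦃a b : A⦄ (f : a ⟶ b), IsIso f → IsIdentity f)
    (hmono : ∀ ⦃a b : A⦄ (f : a ⟶ b), plus f → Mono f) :
    IsRegularSkeletalReedy deg minus plus where
  toIsGeneralizedReedy := hA.toIsGeneralizedReedy
  isSplitEpi := hA.isSplitEpi
  eq_of_sections a b p p' hp hp' h := by
    -- When isomorphisms are identities, a pseudo-section is already a section.
    have key : ∀ (q q' : a ⟶ b), (∀ s : b ⟶ a, s ≫ q = 𝟙 b → s ≫ q' = 𝟙 b) →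
        ∀ ⦃c : A⦄ (i : c ⟶ a), IsPseudoSection q i → IsPseudoSection q' i := by
      intro q q' h c i hi
      obtain ⟨rfl, hi⟩ := hiso _ hi
      unfold IsPseudoSection
      rw [h i (by simpa using hi)]
      infer_instance
    obtain ⟨φ, rfl⟩ := hA.pseudoEqual p p' hp hp' fun c i =>
      ⟨key p p' (fun s => (h s).1) i, key p' p (fun s => (h s).2) i⟩
    obtain ⟨_, hφ⟩ := hiso φ.hom inferInstance
    simp [hφ]
  minus_wide :=
    { id_mem := fun _ => hA.iso_left _ inferInstance
      comp_mem := fun f g hf hg => hA.comp_left f g hf hg }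
  plus_wide :=
    { id_mem := fun _ => hA.iso_right _ inferInstance
      comp_mem := fun f g hf hg => hA.comp_right f g hf hg }
  lowers a b f hf h := hA.deg_minus f hf fun h' => h (hiso f h')
  raises a b f hf h := hA.deg_plus f hf fun h' => h (hiso f h')
  mono_plus := hmono
  unique_factorization a b f := by
    obtain ⟨c, l, r, hl, hr, hlr⟩ := hA.factorization f
    refine ⟨⟨⟨⟨c, l, r, hlr, hl, hr⟩⟩, ?_⟩⟩
    rintro ⟨c', l', r', hlr', hl', hr'⟩
    obtain ⟨t, ⟨ht, ht'⟩, -⟩ := hA.unique_lift l r' l' r hl hr' (hlr'.trans hlr.symm)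
    obtain ⟨t', ⟨-, hu'⟩, -⟩ := hA.unique_lift l' r l r' hl' hr (hlr.trans hlr'.symm)
    have := hmono r hr
    have := hmono r' hr'
    have : IsIso t := ⟨t', by rw [← cancel_mono r, Category.assoc, hu', ht', Category.id_comp],
      by rw [← cancel_mono r', Category.assoc, ht', hu', Category.id_comp]⟩
    obtain ⟨rfl, hti⟩ := hiso t this
    simp only [eqToHom_refl] at hti
    subst hti
    simp only [Category.comp_id, Category.id_comp] at ht ht'
    subst ht ht'
    rfl

end Formal
-- Boolean maps without diagonals.
section BooleanMaps

open Function

variable {ι κ μ : Type*} [DecidableEq ι] [DecidableEq κ]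

/-- The Boolean function `F` depends on its `i`th argument. -/
def Influences (F : (ι → Bool) → Bool) (i : ι) : Prop :=
  ∃ x v, F (update x i v) ≠ F x

/-- `f` has no diagonals: every input coordinate influences at most one output coordinate. -/
def NoDiagonals (f : (ι → Bool) → κ → Bool) : Prop :=
  ∀ i j j', Influences (fun x => f x j) i → Influences (fun x => f x j') i → j = j'

/-- Pass from `x` to `y` one coordinate at a time: a coordinate that influences `F` has the same
value in both, and changing any other leaves `F` unchanged. -/
theorem eq_of_eqOn_influences [Finite ι] {F : (ι → Bool) → Bool} {x y : ι → Bool}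
    (h : ∀ i, Influences F i → x i = y i) : F x = F y := by
  have := Fintype.ofFinite ι
  have key : ∀ s : Finset ι, F (s.piecewise y x) = F x := fun s => by
    induction s using Finset.induction_on with
    | empty => simp
    | insert j s hj ih =>
      rw [Finset.piecewise_insert]
      by_cases hi : Influences F j
      · rw [← h j hi, ← s.piecewise_eq_of_notMem y x hj, update_eq_self, ih]
      · unfold Influences at hi
        push Not at hi
        rw [hi, ih]
  simpa using (key Finset.univ).symm

/-- Two Boolean functions which change along the same edges of the cube have the same kernel. -/
theorem eq_iff_eq_of_update [Finite ι] {F G : (ι → Bool) → Bool}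
    (h : ∀ x i v, F (update x i v) = F x ↔ G (update x i v) = G x) (x y : ι → Bool) :
    F x = F y ↔ G x = G y := by
  have := Fintype.ofFinite ι
  have key : ∀ s : Finset ι, F x = F (s.piecewise y x) ↔ G x = G (s.piecewise y x) := fun s => by
    induction s using Finset.induction_on with
    | empty => simp
    | insert j s hj ih =>
      rw [Finset.piecewise_insert]
      have := h (s.piecewise y x) j (y j)
      generalize F (update (s.piecewise y x) j (y j)) = a at *
      generalize G (update (s.piecewise y x) j (y j)) = b at *
      generalize F (s.piecewise y x) = a' at *
      generalize G (s.piecewise y x) = b' at *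
      -- With only two values, whether the endpoints of a path agree depends on the parity of the
      -- changes along it.
      revert ih this
      generalize F x = a''
      generalize G x = b''
      revert a b a' b' a'' b''
      decide
  simpa using key Finset.univ

theorem NoDiagonals.eq_update {f : (ι → Bool) → κ → Bool} (hf : NoDiagonals f) {x : ι → Bool}
    {i : ι} {v : Bool} {j : κ} (h : f (update x i v) j ≠ f x j) :
    f (update x i v) = update (f x) j (f (update x i v) j) := by
  funext j'
  by_cases hj : j' = j
  · subst hj; simp
  · rw [update_of_ne hj]
    by_contra h'
    exact hj (hf i j' j ⟨x, v, h'⟩ ⟨x, v, h⟩)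

/-- Changing one input of `f` changes at most one output, so a change of `G ∘ f` along an edge is a
change of `G` along an edge. -/
theorem Influences.of_comp {f : (ι → Bool) → κ → Bool} (hf : NoDiagonals f)
    {G : (κ → Bool) → Bool} {i : ι} (h : Influences (fun x => G (f x)) i) :
    ∃ j, Influences (fun x => f x j) i ∧ Influences G j := by
  obtain ⟨x, v, h⟩ := h
  have : f (update x i v) ≠ f x := fun h' => h (congrArg G h')
  obtain ⟨j, hj⟩ := Function.ne_iff.1 this
  refine ⟨j, ⟨x, v, hj⟩, f x, f (update x i v) j, ?_⟩
  rwa [← hf.eq_update hj]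

theorem NoDiagonals.comp {f : (ι → Bool) → κ → Bool} (hf : NoDiagonals f)
    {g : (κ → Bool) → μ → Bool} (hg : NoDiagonals g) : NoDiagonals fun x => g (f x) := by
  intro i k k' h h'
  obtain ⟨j, hij, hjk⟩ := h.of_comp hf (G := fun y => g y k)
  obtain ⟨j', hij', hjk'⟩ := h'.of_comp hf (G := fun y => g y k')
  obtain rfl := hf i j j' hij hij'
  exact hg j k k' hjk hjk'

theorem update_injective_of_ne {F : (ι → Bool) → Bool} {x : ι → Bool} {i : ι} {v : Bool}
    (h : F (update x i v) ≠ F x) : Function.Injective fun b => F (update x i b) := by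
  have hv : v = !x i := by
    by_contra hv
    have : v = x i := by revert hv; cases v <;> cases x i <;> decide
    exact h (by rw [this, update_eq_self])
  subst hv
  have h' : F (update x i (!x i)) ≠ F (update x i (x i)) := by rwa [update_eq_self]
  intro b b' hb
  generalize x i = e at h'
  cases e <;> cases b <;> cases b' <;> first | rfl | exact absurd hb h' | exact absurd hb.symm h'

/-! ### Recovering a map from a common section and its bijective subcubes. -/

section CommonSection

variable [Finite ι] {f g : (ι → Bool) → κ → Bool} (hf : NoDiagonals f) (hg : NoDiagonals g)
  {s : (κ → Bool) → ι → Bool} (hfs : ∀ v, f (s v) = v) (hgs : ∀ v, g (s v) = v)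
  {ψ : ι → Set Bool} (hs : Set.range s = Set.univ.pi ψ)

include hf hfs hs in
/-- The subcube through an edge along which `f · j` changes, spanned by this edge in the
coordinates which influence `f · j`, and by the image of the section `s` in the others, is
carried bijectively by `f`. -/
theorem bijOn_subcube [∀ (F : (ι → Bool) → Bool) i, Decidable (Influences F i)]
    {x : ι → Bool} {i : ι} {v : Bool} {j : κ} (h : f (update x i v) j ≠ f x j) :
    Set.BijOn f (Set.univ.pi fun i' => if Influences (fun x => f x j) i' then
      (if i' = i then Set.univ else {x i'}) else ψ i') Set.univ := by
  have hsψ : ∀ v i', s v i' ∈ ψ i' := fun v i' => by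
    have : s v ∈ Set.univ.pi ψ := hs ▸ Set.mem_range_self v
    exact this i' trivial
  have hψs : ∀ y, (∀ i', y i' ∈ ψ i') → s (f y) = y := fun y hy => by
    have : y ∈ Set.range s := hs ▸ fun i' _ => hy i'
    obtain ⟨v, rfl⟩ := this
    rw [hfs]
  -- Inputs in the block of `j` only affect output `j`, and that output sees nothing else.
  have hmix : ∀ u w, (f fun i' => if Influences (fun x => f x j) i' then u i' else w i') =
      update (f w) j (f u j) := fun u w => by
    funext j'
    by_cases hj : j' = j
    · subst hj
      rw [update_self]
      exact eq_of_eqOn_influences (F := fun x => f x j') fun i' hi' => if_pos hi'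
    · rw [update_of_ne hj]
      exact eq_of_eqOn_influences (F := fun x => f x j') fun i' hi' =>
        if_neg fun hi => hj (hf i' _ _ hi' hi)
  have hinj := update_injective_of_ne (F := fun x => f x j) h
  refine ⟨Set.mapsTo_univ _ _, ?_, ?_⟩
  · intro c hc c' hc' hcc
    have hout : ∀ d, d ∈ (Set.univ.pi fun i' => if Influences (fun x => f x j) i' then
        (if i' = i then Set.univ else {x i'}) else ψ i') → ∀ i',
        ¬ Influences (fun x => f x j) i' → d i' = s (f d) i' := fun d hd i' hi' => by
      have h1 := hψs (fun i' => if Influences (fun x => f x j) i' then s (f d) i' else d i')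
        (fun i' => by
          have := hd i' trivial
          by_cases hi : Influences (fun x => f x j) i'
          · simpa [hi] using hsψ _ i'
          · simpa [hi] using this)
      rw [hmix, hfs, update_eq_self] at h1
      have := congrFun h1 i'
      simpa [hi'] using this.symm
    have hin : ∀ d, d ∈ (Set.univ.pi fun i' => if Influences (fun x => f x j) i' then
        (if i' = i then Set.univ else {x i'}) else ψ i') → ∀ i',
        Influences (fun x => f x j) i' → d i' = update x i (d i) i' := fun d hd i' hi' => by
      have := hd i' trivial
      by_cases hi : i' = i
      · subst hi; simp
      · simpa [hi', hi] using this
    have hi : c i = c' i := by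
      apply hinj
      have h1 := eq_of_eqOn_influences (F := fun x => f x j) (hin c hc)
      have h2 := eq_of_eqOn_influences (F := fun x => f x j) (hin c' hc')
      simp only [← h1, ← h2, hcc]
    funext i'
    by_cases hi' : Influences (fun x => f x j) i'
    · rw [hin c hc i' hi', hin c' hc' i' hi', hi]
    · rw [hout c hc i' hi', hout c' hc' i' hi', hcc]
  · intro v _
    obtain ⟨b, hb⟩ := (Finite.injective_iff_surjective.1 hinj) (v j)
    refine ⟨fun i' => if Influences (fun x => f x j) i' then update x i b i' else s v i',
      fun i' _ => ?_, ?_⟩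
    · by_cases hi' : Influences (fun x => f x j) i'
      · by_cases hi : i' = i
        · subst hi; simp [hi']
        · simp [hi', hi]
      · simpa [hi'] using hsψ v i'
    · rw [hmix, hfs]
      simp only at hb
      rw [hb, update_eq_self]

include hf hg hfs hgs hs in
-- The test subcube for the given edge is also carried bijectively by `g`, so it contains points
-- where `g · j` takes both values. These points agree at every input of `g · j` other than `i`, so
-- `g · j` changes in direction `i`.
theorem exists_ne_of_bijOn
    (hC : ∀ φ : ι → Set Bool, (∀ i, (φ i).Nonempty) →
      Set.BijOn f (Set.univ.pi φ) Set.univ → Set.BijOn g (Set.univ.pi φ) Set.univ)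
    {x : ι → Bool} {i : ι} {v : Bool} {j : κ} (h : f (update x i v) j ≠ f x j) :
    ∃ c, (∀ i', Influences (fun x => f x j) i' → i' ≠ i → c i' = x i') ∧
      ∃ b, g (update c i b) j ≠ g c j := by
  classical
  have hsψ : ∀ v i', s v i' ∈ ψ i' := fun v i' => by
    have : s v ∈ Set.univ.pi ψ := hs ▸ Set.mem_range_self v
    exact this i' trivial
  have hψs : ∀ y, (∀ i', y i' ∈ ψ i') → ∃ v, s v = y := fun y hy => by
    have : y ∈ Set.range s := hs ▸ fun i' _ => hy i'
    exact this
  have hbij := hC _ (fun i' => by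
    by_cases hi' : Influences (fun x => f x j) i'
    · by_cases hi : i' = i
      · subst hi; simp [hi']
      · simp [hi', hi]
    · simpa [hi'] using ⟨_, hsψ (f x) i'⟩) (bijOn_subcube hf hfs hs h)
  obtain ⟨c, hc, hc1⟩ := hbij.surjOn (Set.mem_univ fun _ => true)
  obtain ⟨c', hc', hc1'⟩ := hbij.surjOn (Set.mem_univ fun _ => false)
  have agree : ∀ i', Influences (fun x => g x j) i' → i' ≠ i → c i' = c' i' := by
    intro i' hgi hne
    have h1 := hc i' trivial
    have h2 := hc' i' trivial
    by_cases hi' : Influences (fun x => f x j) i'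
    · simp only [hi', hne, if_true, if_false, Set.mem_singleton_iff] at h1 h2
      rw [h1, h2]
    · simp only [hi', if_false] at h1 h2
      by_contra hcc
      -- If `i'` were free in the image of `s`, moving it there would change some output `k` of both
      -- `f` and `g`. As `i'` influences `g · j`, this forces `k = j`, so `i'` would influence `f ·
      -- j` too.
      have huniv : ∀ b, b ∈ ψ i' := fun b => by
        rcases Bool.eq_or_eq_not b (c i') with rfl | hb
        · exact h1
        · have : b = c' i' := by
            rw [hb]; revert hcc; cases c i' <;> cases c' i' <;> decide
          exact this ▸ h2
      obtain ⟨v', hv'⟩ := hψs (update (s (f x)) i' (!s (f x) i')) (fun k => by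
        by_cases hk : k = i'
        · subst hk; exact huniv _
        · rw [update_of_ne hk]; exact hsψ _ k)
      have hne' : v' ≠ f x := by
        rintro rfl
        have := congrFun hv' i'
        simp at this
      obtain ⟨k, hk⟩ := Function.ne_iff.1 hne'
      have hfk : Influences (fun x => f x k) i' :=
        ⟨s (f x), !s (f x) i', by simpa only [← hv', hfs] using hk⟩
      have hgk : Influences (fun x => g x k) i' :=
        ⟨s (f x), !s (f x) i', by simpa only [← hv', hgs] using hk⟩
      exact hi' (hg i' k j hgk hgi ▸ hfk)
  refine ⟨c', fun i' hi' hne => ?_, c i, ?_⟩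
  · have h2 := hc' i' trivial
    simpa only [hi', hne, if_true, if_false, Set.mem_singleton_iff] using h2
  · have : g (update c' i (c i)) j = g c j :=
      eq_of_eqOn_influences (F := fun x => g x j) fun i' hi' => by
        by_cases hne : i' = i
        · subst hne; simp
        · rw [update_of_ne hne, agree i' hi' hne]
    rw [this, hc1, hc1']
    simp

include hf hg hfs hgs hs in
/-- A map without diagonals which has a section whose image is a subcube is determined by this
section and by the subcubes which it carries bijectively. -/
theorem eq_of_bijOn_iff_bijOn
    (hC : ∀ φ : ι → Set Bool, (∀ i, (φ i).Nonempty) →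
      (Set.BijOn f (Set.univ.pi φ) Set.univ ↔ Set.BijOn g (Set.univ.pi φ) Set.univ)) :
    f = g := by
  have h1 := fun x i v j => exists_ne_of_bijOn (x := x) (i := i) (v := v) (j := j)
    hf hg hfs hgs hs fun φ hφ => (hC φ hφ).1
  have h2 := fun x i v j => exists_ne_of_bijOn (x := x) (i := i) (v := v) (j := j)
    hg hf hgs hfs hs fun φ hφ => (hC φ hφ).2
  have hinf : ∀ i j, Influences (fun x => f x j) i ↔ Influences (fun x => g x j) i := by
    refine fun i j => ⟨fun ⟨x, v, h⟩ => ?_, fun ⟨x, v, h⟩ => ?_⟩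
    · obtain ⟨c, -, b, hb⟩ := h1 x i v j h
      exact ⟨c, b, hb⟩
    · obtain ⟨c, -, b, hb⟩ := h2 x i v j h
      exact ⟨c, b, hb⟩
  -- The change was found at `c`, not at `x`. Once the inputs influencing `F` are known to agree
  -- away from `i`, it carries over to the edge at `x`.
  have transfer : ∀ {F : (ι → Bool) → Bool} {x c : ι → Bool} {i : ι} {v b : Bool},
      (∀ i', Influences F i' → i' ≠ i → c i' = x i') → F (update c i b) ≠ F c →
      v ≠ x i → F (update x i v) ≠ F x := by
    intro F x c i v b hxc hb hv
    have hinj := update_injective_of_ne hb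
    have : ∀ b, F (update x i b) = F (update c i b) := fun b =>
      eq_of_eqOn_influences fun i' hi' => by
        by_cases hne : i' = i
        · subst hne; simp
        · rw [update_of_ne hne, update_of_ne hne, hxc i' hi' hne]
    intro h
    apply hv
    apply hinj
    simp only [← this]
    rw [h, update_eq_self]
  have edge : ∀ j x i v, f (update x i v) j = f x j ↔ g (update x i v) j = g x j := by
    intro j x i v
    by_cases hv : v = x i
    · subst hv; simp
    refine not_iff_not.1 ⟨fun h => ?_, fun h => ?_⟩
    · obtain ⟨c, hc, b, hb⟩ := h1 x i v j h
      exact transfer (F := fun x => g x j) (fun i' hi' => hc i' ((hinf i' j).2 hi')) hb hv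
    · obtain ⟨c, hc, b, hb⟩ := h2 x i v j h
      exact transfer (F := fun x => f x j) (fun i' hi' => hc i' ((hinf i' j).1 hi')) hb hv
  funext x j
  -- Components changing along the same edges have the same kernel. Since `x` and `s (f x)` have the
  -- same image under `f`, they have the same image under `g`, and `g (s (f x)) = f x`.
  have := (eq_iff_eq_of_update (F := fun x => f x j) (G := fun x => g x j) (edge j)
    x (s (f x))).1 (by simp only [hfs])
  simp only [hgs] at this
  exact this.symm

end CommonSection

end BooleanMaps
-- Products of maps, and invariants of the morphisms of the site.
section Cubes

open Function

section AppendMap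

variable {k l m n k' l' m' n' : ℕ} (f : (Fin m → Bool) → Fin n → Bool)
  (g : (Fin m' → Bool) → Fin n' → Bool)

/-- Apply `f` to the first coordinates and `g` to the others. -/
def appendMap (x : Fin (m + m') → Bool) : Fin (n + n') → Bool :=
  Fin.append (f fun i => x (Fin.castAdd m' i)) (g fun i => x (Fin.natAdd m i))

theorem appendMap_castAdd (x : Fin (m + m') → Bool) (j : Fin n) :
    appendMap f g x (Fin.castAdd n' j) = f (fun i => x (Fin.castAdd m' i)) j :=
  Fin.append_left _ _ _

theorem appendMap_natAdd (x : Fin (m + m') → Bool) (j : Fin n') :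
    appendMap f g x (Fin.natAdd n j) = g (fun i => x (Fin.natAdd m i)) j :=
  Fin.append_right _ _ _

theorem appendMap_append (x : Fin m → Bool) (y : Fin m' → Bool) :
    appendMap f g (Fin.append x y) = Fin.append (f x) (g y) := by
  simp [appendMap]

theorem appendMap_comp (f' : (Fin l → Bool) → Fin m → Bool) (g' : (Fin l' → Bool) → Fin m' → Bool)
    (x : Fin (l + l') → Bool) :
    appendMap (fun y => f (f' y)) (fun y => g (g' y)) x = appendMap f g (appendMap f' g' x) :=
  (appendMap_append f g _ _).symm

theorem append_hom_ext {ι : Type*} {f g : ι → Fin (n + n') → Bool}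
    (h : ∀ x j, f x (Fin.castAdd n' j) = g x (Fin.castAdd n' j))
    (h' : ∀ x j, f x (Fin.natAdd n j) = g x (Fin.natAdd n j)) : f = g :=
  funext fun x => funext fun j => Fin.addCases (h x) (h' x) j

/-- The image of a subcube under a product of maps. -/
theorem image_appendMap (φ : Fin (m + m') → Set Bool) {ψ : Fin n → Set Bool} {ψ' : Fin n' → Set Bool}
    (hf : f '' Set.univ.pi (fun i => φ (Fin.castAdd m' i)) = Set.univ.pi ψ)
    (hg : g '' Set.univ.pi (fun i => φ (Fin.natAdd m i)) = Set.univ.pi ψ') :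
    appendMap f g '' Set.univ.pi φ = Set.univ.pi (Fin.append ψ ψ') := by
  ext y
  constructor
  · rintro ⟨x, hx, rfl⟩
    have h1 : f (fun i => x (Fin.castAdd m' i)) ∈ Set.univ.pi ψ :=
      hf ▸ ⟨_, fun i _ => hx (Fin.castAdd m' i) trivial, rfl⟩
    have h2 : g (fun i => x (Fin.natAdd m i)) ∈ Set.univ.pi ψ' :=
      hg ▸ ⟨_, fun i _ => hx (Fin.natAdd m i) trivial, rfl⟩
    intro j _
    refine Fin.addCases (fun j => ?_) (fun j => ?_) j
    · rw [appendMap_castAdd, Fin.append_left]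
      exact h1 j trivial
    · rw [appendMap_natAdd, Fin.append_right]
      exact h2 j trivial
  · intro hy
    have h1 : (fun j => y (Fin.castAdd n' j)) ∈ Set.univ.pi ψ := fun j _ => by
      have := hy (Fin.castAdd n' j) trivial
      rwa [Fin.append_left] at this
    have h2 : (fun j => y (Fin.natAdd n j)) ∈ Set.univ.pi ψ' := fun j _ => by
      have := hy (Fin.natAdd n j) trivial
      rwa [Fin.append_right] at this
    rw [← hf] at h1
    rw [← hg] at h2
    obtain ⟨x, hx, hfx⟩ := h1
    obtain ⟨x', hx', hgx⟩ := h2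
    refine ⟨Fin.append x x', fun i _ => ?_, ?_⟩
    · refine Fin.addCases (fun i => ?_) (fun i => ?_) i
      · rw [Fin.append_left]
        exact hx i trivial
      · rw [Fin.append_right]
        exact hx' i trivial
    · rw [appendMap_append, hfx, hgx]
      exact Fin.append_castAdd_natAdd

variable {f g} in
theorem Influences.of_appendMap_castAdd {i : Fin (m + m')} {j : Fin n}
    (h : Influences (fun x => appendMap f g x (Fin.castAdd n' j)) i) :
    ∃ i', i = Fin.castAdd m' i' ∧ Influences (fun x => f x j) i' := by
  obtain ⟨x, v, h⟩ := h
  simp only [appendMap_castAdd] at h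
  induction i using Fin.addCases with
  | left i =>
    refine ⟨i, rfl, fun i => x (Fin.castAdd m' i), v, ?_⟩
    rw [← Function.update_comp_eq_of_injective' x (Fin.castAdd_injective _ _)]
    exact h
  | right i =>
    refine absurd ?_ h
    congr 1
    funext k
    rw [update_of_ne]
    simp only [ne_eq, Fin.ext_iff, Fin.val_castAdd, Fin.val_natAdd]
    omega

variable {f g} in
theorem Influences.of_appendMap_natAdd {i : Fin (m + m')} {j : Fin n'}
    (h : Influences (fun x => appendMap f g x (Fin.natAdd n j)) i) :
    ∃ i', i = Fin.natAdd m i' ∧ Influences (fun x => g x j) i' := by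
  obtain ⟨x, v, h⟩ := h
  simp only [appendMap_natAdd] at h
  induction i using Fin.addCases with
  | right i =>
    refine ⟨i, rfl, fun i => x (Fin.natAdd m i), v, ?_⟩
    rw [← Function.update_comp_eq_of_injective' x (Fin.natAdd_injective _ _)]
    exact h
  | left i =>
    refine absurd ?_ h
    congr 1
    funext k
    rw [update_of_ne]
    simp only [ne_eq, Fin.ext_iff, Fin.val_castAdd, Fin.val_natAdd]
    omega

end AppendMap

namespace Cube

theorem comp_apply {a b c : Cube} (f : a ⟶ b) (g : b ⟶ c) (x : a.Vertex) :
    (f ≫ g) x = g (f x) := rfl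

theorem tensorMap_comp {a b c a' b' c' : Cube} (f : a ⟶ b) (g : b ⟶ c) (f' : a' ⟶ b')
    (g' : b' ⟶ c') :
    tensorMap (f ≫ g) (f' ≫ g') = tensorMap f f' ≫ tensorMap g g' :=
  funext fun x => appendMap_comp g g' f f' x

theorem tensorMap_id (a a' : Cube) : tensorMap (𝟙 a) (𝟙 a') = 𝟙 (a.tensor a') :=
  append_hom_ext (appendMap_castAdd _ _) (appendMap_natAdd _ _)

end Cube

open CubicalSites.Cube

/-- The blocks of input coordinates which influence the output coordinates of `f` are arranged
in the order of the output coordinates. -/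
def OrderedBlocks {m n : ℕ} (f : (Fin m → Bool) → Fin n → Bool) : Prop :=
  ∀ i i' j j', Influences (fun x => f x j) i → Influences (fun x => f x j') i' → i < i' → j ≤ j'

/-- If two inputs reach the same intermediate coordinate, that coordinate influences at most one
output of `g`; this is where absence of diagonals is needed. -/
theorem OrderedBlocks.comp {l m n : ℕ} {f : (Fin l → Bool) → Fin m → Bool}
    (hf : OrderedBlocks f) (hfd : NoDiagonals f) {g : (Fin m → Bool) → Fin n → Bool}
    (hg : OrderedBlocks g) (hgd : NoDiagonals g) : OrderedBlocks fun x => g (f x) := by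
  intro i i' k k' h h' hi
  obtain ⟨j, hij, hjk⟩ := h.of_comp hfd (G := fun y => g y k)
  obtain ⟨j', hij', hjk'⟩ := h'.of_comp hfd (G := fun y => g y k')
  rcases (hf i i' j j' hij hij' hi).lt_or_eq with hj | rfl
  · exact hg j j' k k' hjk hjk' hj
  · exact (hgd j k k' hjk hjk').le

variable {S : Signature}

theorem monoidalClosure_mono {G H : MorphismProperty Cube} (h : G ≤ H) {a b : Cube} {f : a ⟶ b}
    (hf : monoidalClosure G f) : monoidalClosure H f := by
  induction hf with
  | of f hf => exact .of f (h f hf)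
  | id a => exact .id a
  | comp f g _ _ ihf ihg => exact .comp f g ihf ihg
  | tensor f g _ _ ihf ihg => exact .tensor f g ihf ihg

/-- Generators of the isomorphisms of the cubical site. -/
inductive Signature.IsoGen (S : Signature) : MorphismProperty Cube
  | sym (h : S.hasSym = true) : S.IsoGen symMap
  | rev (h : S.hasRev = true) : S.IsoGen revMap

theorem Signature.isoGen_le_minusGen : S.IsoGen ≤ S.MinusGen := by
  rintro _ _ _ (h | h)
  exacts [.sym h, .rev h]

theorem Signature.isoGen_le_plusGen : S.IsoGen ≤ S.PlusGen := by
  rintro _ _ _ (h | h)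
  exacts [.sym h, .rev h]

section Invariants

theorem noDiagonals_appendMap {m n m' n' : ℕ} {f : (Fin m → Bool) → Fin n → Bool}
    {g : (Fin m' → Bool) → Fin n' → Bool} (hf : NoDiagonals f) (hg : NoDiagonals g) :
    NoDiagonals (appendMap f g) := by
  intro i j j' h h'
  refine Fin.addCases (m := n) (n := n')
    (motive := fun j => Influences (fun x => appendMap f g x j) i → j = j')
    (fun j h => ?_) (fun j h => ?_) j h
  all_goals
    refine Fin.addCases (m := n) (n := n')
      (motive := fun j' => Influences (fun x => appendMap f g x j') i → _ = j')
      (fun j' h' => ?_) (fun j' h' => ?_) j' h'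
  · obtain ⟨i, rfl, hk⟩ := h.of_appendMap_castAdd
    obtain ⟨i', hi, hk'⟩ := h'.of_appendMap_castAdd
    obtain rfl := Fin.castAdd_injective _ _ hi
    rw [hf _ _ _ hk hk']
  · obtain ⟨i, rfl, hk⟩ := h.of_appendMap_castAdd
    obtain ⟨i', hi, hk'⟩ := h'.of_appendMap_natAdd
    simp only [Fin.ext_iff, Fin.val_castAdd, Fin.val_natAdd] at hi
    omega
  · obtain ⟨i, rfl, hk⟩ := h.of_appendMap_natAdd
    obtain ⟨i', hi, hk'⟩ := h'.of_appendMap_castAdd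
    simp only [Fin.ext_iff, Fin.val_castAdd, Fin.val_natAdd] at hi
    omega
  · obtain ⟨i, rfl, hk⟩ := h.of_appendMap_natAdd
    obtain ⟨i', hi, hk'⟩ := h'.of_appendMap_natAdd
    obtain rfl := Fin.natAdd_injective _ _ hi
    rw [hg _ _ _ hk hk']

theorem orderedBlocks_appendMap {m n m' n' : ℕ} {f : (Fin m → Bool) → Fin n → Bool}
    {g : (Fin m' → Bool) → Fin n' → Bool} (hf : OrderedBlocks f) (hg : OrderedBlocks g) :
    OrderedBlocks (appendMap f g) := by
  intro i i' j j' h h' hi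
  refine Fin.addCases (m := n) (n := n')
    (motive := fun j => Influences (fun x => appendMap f g x j) i → j ≤ j')
    (fun j h => ?_) (fun j h => ?_) j h
  all_goals
    refine Fin.addCases (m := n) (n := n')
      (motive := fun j' => Influences (fun x => appendMap f g x j') i' → _ ≤ j')
      (fun j' h' => ?_) (fun j' h' => ?_) j' h'
  · obtain ⟨i, rfl, hk⟩ := h.of_appendMap_castAdd
    obtain ⟨i', rfl, hk'⟩ := h'.of_appendMap_castAdd
    exact hf _ _ _ _ hk hk' hi
  · rw [Fin.le_def, Fin.val_castAdd, Fin.val_natAdd]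
    omega
  · obtain ⟨i, rfl, hk⟩ := h.of_appendMap_natAdd
    obtain ⟨i', rfl, hk'⟩ := h'.of_appendMap_castAdd
    rw [Fin.lt_def, Fin.val_castAdd, Fin.val_natAdd] at hi
    omega
  · obtain ⟨i, rfl, hk⟩ := h.of_appendMap_natAdd
    obtain ⟨i', rfl, hk'⟩ := h'.of_appendMap_natAdd
    have hii : i < i' := by
      rw [Fin.lt_def, Fin.val_natAdd, Fin.val_natAdd] at hi
      exact Fin.lt_def.2 (by omega)
    have := Fin.le_def.1 (hg _ _ _ _ hk hk' hii)
    rw [Fin.le_def, Fin.val_natAdd, Fin.val_natAdd]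
    omega

theorem noDiagonals_of_subsingleton {ι κ : Type*} [DecidableEq ι] [Subsingleton κ]
    (f : (ι → Bool) → κ → Bool) : NoDiagonals f := fun _ _ _ _ _ => Subsingleton.elim _ _

theorem noDiagonals_symMap : NoDiagonals (symMap : (Fin 2 → Bool) → Fin 2 → Bool) := by
  unfold NoDiagonals Influences symMap
  decide

theorem noDiagonals_of_mem {a b : Cube} {f : a ⟶ b}
    (hf : monoidalClosure (S.MinusGen ⊔ S.PlusGen) f) :
    NoDiagonals (f : a.Vertex → b.Vertex) := by
  induction hf with
  | of f hf =>
    rcases hf with (_ | h | h | h | h) | (ε | h | h)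
    · exact noDiagonals_of_subsingleton (κ := Fin 0) _
    · exact noDiagonals_of_subsingleton (κ := Fin 1) _
    · exact noDiagonals_of_subsingleton (κ := Fin 1) _
    · exact noDiagonals_symMap
    · exact noDiagonals_of_subsingleton (κ := Fin 1) _
    · exact noDiagonals_of_subsingleton (κ := Fin 1) _
    · exact noDiagonals_symMap
    · exact noDiagonals_of_subsingleton (κ := Fin 1) _
  | id a =>
    have key : ∀ i j, Influences (fun x : a.Vertex => x j) i → j = i := by
      rintro i j ⟨x, v, h⟩
      by_contra hne
      exact h (update_of_ne hne _ _)
    exact fun i j j' h h' => (key i j h).trans (key i j' h').symm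
  | comp f g _ _ ihf ihg => exact ihf.comp ihg
  | tensor f g _ _ ihf ihg => exact noDiagonals_appendMap ihf ihg

theorem orderedBlocks_of_subsingleton {m n : ℕ} [Subsingleton (Fin n)]
    (f : (Fin m → Bool) → Fin n → Bool) : OrderedBlocks f :=
  fun _ _ _ _ _ _ _ => (Subsingleton.elim _ _).le

theorem orderedBlocks_of_mem (hS : S.hasSym = false) {a b : Cube} {f : a ⟶ b}
    (hf : monoidalClosure (S.MinusGen ⊔ S.PlusGen) f) :
    OrderedBlocks (f : a.Vertex → b.Vertex) := by
  induction hf with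
  | of f hf =>
    rcases hf with (_ | h | h | h | h) | (ε | h | h)
    · exact orderedBlocks_of_subsingleton (n := 0) _
    · exact orderedBlocks_of_subsingleton (n := 1) _
    · exact orderedBlocks_of_subsingleton (n := 1) _
    · simp [hS] at h
    · exact orderedBlocks_of_subsingleton (n := 1) _
    · exact orderedBlocks_of_subsingleton (n := 1) _
    · simp [hS] at h
    · exact orderedBlocks_of_subsingleton (n := 1) _
  | id a =>
    have key : ∀ i j, Influences (fun x : a.Vertex => x j) i → j = i := by
      rintro i j ⟨x, v, h⟩
      by_contra hne
      exact h (update_of_ne hne _ _)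
    intro i i' j j' h h' hi
    rw [key i j h, key i' j' h']
    exact hi.le
  | comp f g hf hg ihf ihg =>
    exact ihf.comp (noDiagonals_of_mem hf) ihg (noDiagonals_of_mem hg)
  | tensor f g _ _ ihf ihg => exact orderedBlocks_appendMap ihf ihg

theorem monotone_of_mem (hS : S.hasRev = false) {a b : Cube} {f : a ⟶ b}
    (hf : monoidalClosure (S.MinusGen ⊔ S.PlusGen) f) :
    ∀ x y : a.Vertex, (∀ i, x i ≤ y i) → ∀ j, f x j ≤ f y j := by
  induction hf with
  | of f hf =>
    have hsym : ∀ x y : Fin 2 → Bool, (∀ i, x i ≤ y i) →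
        ∀ j : Fin 2, ![x 1, x 0] j ≤ ![y 1, y 0] j := by decide
    rcases hf with (_ | h | h | h | h) | (ε | h | h)
    · exact fun x y h j => j.elim0
    · have : ∀ x y : Fin 2 → Bool, (∀ i, x i ≤ y i) → (x 0 && x 1) ≤ (y 0 && y 1) := by decide
      exact fun x y h j => this x y h
    · have : ∀ x y : Fin 2 → Bool, (∀ i, x i ≤ y i) → (x 0 || x 1) ≤ (y 0 || y 1) := by decide
      exact fun x y h j => this x y h
    · exact hsym
    · simp [hS] at h
    · exact fun x y h j => le_rfl
    · exact hsym
    · simp [hS] at h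
  | id a => exact fun x y h => h
  | comp f g _ _ ihf ihg => exact fun x y h => ihg _ _ (ihf x y h)
  | @tensor a b a' b' f g _ _ ihf ihg =>
    refine fun x y h => (Fin.forall_fin_add _).2 ⟨fun j => ?_, fun j => ?_⟩
    · exact (appendMap_castAdd f g x j).trans_le <| (ihf _ _ (fun i => h _) j).trans_eq
        (appendMap_castAdd f g y j).symm
    · exact (appendMap_natAdd f g x j).trans_le <| (ihg _ _ (fun i => h _) j).trans_eq
        (appendMap_natAdd f g y j).symm

end Invariants

end Cubes
-- Bijective morphisms are signed permutations.
section Isomorphisms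

open Function CubicalSites.Cube

variable {S : Signature}

theorem revMap_comp_revMap : revMap ≫ revMap = 𝟙 (Cube.mk 1) := by
  funext x i
  obtain rfl : i = 0 := Subsingleton.elim (α := Fin 1) _ _
  exact Bool.not_not _

theorem symMap_comp_symMap : symMap ≫ symMap = 𝟙 (Cube.mk 2) := by
  funext x
  have : ∀ x : Fin 2 → Bool, ![![x 1, x 0] 1, ![x 1, x 0] 0] = x := by decide
  exact this x

theorem exists_inverse_of_isoGen {a b : Cube} {f : a ⟶ b} (hf : monoidalClosure S.IsoGen f) :
    ∃ g : b ⟶ a, monoidalClosure S.IsoGen g ∧ f ≫ g = 𝟙 a ∧ g ≫ f = 𝟙 b := by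
  induction hf with
  | of f hf =>
    rcases hf with h | h
    · exact ⟨symMap, .of _ (.sym h), symMap_comp_symMap, symMap_comp_symMap⟩
    · exact ⟨revMap, .of _ (.rev h), revMap_comp_revMap, revMap_comp_revMap⟩
  | id a => exact ⟨𝟙 a, .id a, Category.id_comp _, Category.id_comp _⟩
  | comp f g _ _ ihf ihg =>
    obtain ⟨f', hf', h1, h2⟩ := ihf
    obtain ⟨g', hg', h3, h4⟩ := ihg
    exact ⟨g' ≫ f', .comp _ _ hg' hf', by rw [Category.assoc, reassoc_of% h3, h1],
      by rw [Category.assoc, reassoc_of% h2, h4]⟩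
  | tensor f g _ _ ihf ihg =>
    obtain ⟨f', hf', h1, h2⟩ := ihf
    obtain ⟨g', hg', h3, h4⟩ := ihg
    exact ⟨tensorMap f' g', .tensor _ _ hf' hg', by rw [← tensorMap_comp, h1, h3, tensorMap_id],
      by rw [← tensorMap_comp, h2, h4, tensorMap_id]⟩

theorem isoGen_le_minus {a b : Cube} {f : a ⟶ b} (hf : monoidalClosure S.IsoGen f) :
    monoidalClosure S.MinusGen f := monoidalClosure_mono Signature.isoGen_le_minusGen hf

theorem isoGen_le_plus {a b : Cube} {f : a ⟶ b} (hf : monoidalClosure S.IsoGen f) :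
    monoidalClosure S.PlusGen f := monoidalClosure_mono Signature.isoGen_le_plusGen hf

theorem minus_le_site {a b : Cube} {f : a ⟶ b} (hf : monoidalClosure S.MinusGen f) :
    monoidalClosure (S.MinusGen ⊔ S.PlusGen) f := monoidalClosure_mono le_sup_left hf

theorem plus_le_site {a b : Cube} {f : a ⟶ b} (hf : monoidalClosure S.PlusGen f) :
    monoidalClosure (S.MinusGen ⊔ S.PlusGen) f := monoidalClosure_mono le_sup_right hf

/-- Permute the coordinates. -/
def permMap {n : ℕ} (e : Equiv.Perm (Fin n)) : Cube.mk n ⟶ Cube.mk n := fun x i => x (e i)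

/-- Reverse some of the coordinates. -/
def signMap {n : ℕ} (ε : Fin n → Bool) : Cube.mk n ⟶ Cube.mk n := fun x i => xor (x i) (ε i)

theorem signMap_mem (h : S.hasRev = true) :
    ∀ {n : ℕ} (ε : Fin n → Bool), monoidalClosure S.IsoGen (signMap ε)
  | 0, ε => by
    have : signMap ε = 𝟙 (Cube.mk 0) := funext fun x => funext fun i => i.elim0
    exact this ▸ .id _
  | n + 1, ε => by
    have hlast : ∃ g : Cube.mk 1 ⟶ Cube.mk 1, monoidalClosure S.IsoGen g ∧
        ∀ x i, g x i = xor (x i) (ε (Fin.last n)) := by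
      cases ε (Fin.last n) with
      | false => exact ⟨𝟙 _, .id _, fun x i => (Bool.xor_false _).symm⟩
      | true =>
        refine ⟨revMap, .of _ (.rev h), fun x i => ?_⟩
        obtain rfl : i = 0 := Subsingleton.elim (α := Fin 1) _ _
        exact (Bool.xor_true _).symm
    obtain ⟨g, hg, hgε⟩ := hlast
    have key : signMap ε = tensorMap (signMap fun i : Fin n => ε (Fin.castAdd 1 i)) g := by
      refine append_hom_ext (n := n) (n' := 1) (fun x j => ?_) (fun x j => ?_)
      · exact (appendMap_castAdd (signMap fun i : Fin n => ε (Fin.castAdd 1 i)) g x j).symm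
      · refine Eq.trans ?_ (appendMap_natAdd (m := n) (n := n) _ _ x j).symm
        refine Eq.trans ?_ (hgε _ _).symm
        obtain rfl : j = 0 := Subsingleton.elim (α := Fin 1) _ _
        rfl
    exact key ▸ .tensor _ _ (signMap_mem h _) hg

/-- An adjacent transposition is the symmetry tensored with identities on `i` and `k` coordinates.
-/
theorem permMap_swap_mem (h : S.hasSym = true) {m : ℕ} (i k : ℕ) (hm : m = i + (2 + k))
    (p q : Fin m) (hp : p.val = i) (hq : q.val = i + 1) :
    monoidalClosure S.IsoGen (permMap (Equiv.swap p q)) := by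
  subst hm
  have key : permMap (Equiv.swap p q) =
      tensorMap (𝟙 (Cube.mk i)) (tensorMap symMap (𝟙 (Cube.mk k))) := by
    have hne : ∀ (x : Fin (i + (2 + k)) → Bool) (r : Fin (i + (2 + k))), r.val ≠ i →
        r.val ≠ i + 1 → x (Equiv.swap p q r) = x r := fun x r h1 h2 => by
      rw [Equiv.swap_apply_of_ne_of_ne]
      · intro h; exact h1 (h ▸ hp)
      · intro h; exact h2 (h ▸ hq)
    refine append_hom_ext (n := i) (n' := 2 + k) (fun x j => ?_) (fun x j => ?_)
    · refine Eq.trans ?_ (appendMap_castAdd (n' := 2 + k) _ _ x j).symm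
      have := j.isLt
      exact hne x (Fin.castAdd (2 + k) j) (by rw [Fin.val_castAdd]; omega)
        (by rw [Fin.val_castAdd]; omega)
    · refine Eq.trans ?_ (appendMap_natAdd (m := i) (n := i) _ _ x j).symm
      refine Fin.addCases (m := 2) (n := k) (fun j => ?_) (fun j => ?_) j
      · refine Eq.trans ?_ (appendMap_castAdd symMap (𝟙 (Cube.mk k))
          (fun r => x (Fin.natAdd i r)) j).symm
        have hp0 : p = Fin.natAdd i (Fin.castAdd k (0 : Fin 2)) := Fin.ext hp
        have hq0 : q = Fin.natAdd i (Fin.castAdd k (1 : Fin 2)) := Fin.ext hq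
        fin_cases j
        · exact congrArg x ((congrArg _ hp0.symm).trans ((Equiv.swap_apply_left p q).trans hq0))
        · exact congrArg x ((congrArg _ hq0.symm).trans ((Equiv.swap_apply_right p q).trans hp0))
      · refine Eq.trans ?_ (appendMap_natAdd symMap (𝟙 (Cube.mk k))
          (fun r => x (Fin.natAdd i r)) j).symm
        exact hne x (Fin.natAdd i (Fin.natAdd 2 j)) (by simp only [Fin.val_natAdd]; omega)
          (by simp only [Fin.val_natAdd]; omega)
  exact key ▸ .tensor _ _ (.id _) (.tensor _ _ (.of _ (.sym h)) (.id _))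

theorem permMap_mem (h : S.hasSym = true) :
    ∀ {n : ℕ} (e : Equiv.Perm (Fin n)), monoidalClosure S.IsoGen (permMap e)
  | 0, e => by
    have : permMap e = 𝟙 (Cube.mk 0) := funext fun x => funext fun i => i.elim0
    exact this ▸ .id _
  | n + 1, e => by
    have he : e ∈ Submonoid.closure
        (Set.range fun i : Fin n => Equiv.swap i.castSucc i.succ) :=
      Equiv.Perm.mclosure_swap_castSucc_succ n ▸ Submonoid.mem_top e
    induction he using Submonoid.closure_induction with
    | mem e he =>
      obtain ⟨i, rfl⟩ := he
      have := i.isLt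
      exact permMap_swap_mem h i.val (n - 1 - i.val) (by omega) _ _ rfl rfl
    | one => exact .id _
    -- No order reversal appears: permuting coordinates is contravariant, and `≫` is written in
    -- diagrammatic order.
    | mul e e' _ _ ih ih' => exact .comp (permMap e) (permMap e') ih ih'

/-- A bijective morphism of the site is a composite of symmetries and reversals. -/
theorem isoGen_of_bijective_aux {n : ℕ} {f : Cube.mk n ⟶ Cube.mk n}
    (hf : monoidalClosure (S.MinusGen ⊔ S.PlusGen) f)
    (hbij : Bijective (f : (Cube.mk n).Vertex → (Cube.mk n).Vertex)) :
    monoidalClosure S.IsoGen f := by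
  have hd : NoDiagonals (f : (Fin n → Bool) → Fin n → Bool) := noDiagonals_of_mem hf
  -- An output without influencing input would be constant, against surjectivity. Absence of
  -- diagonals then makes the choice `e` injective, hence a permutation.
  have hex : ∀ j : Fin n, ∃ i : Fin n, Influences (fun x : Fin n → Bool => f x j) i := by
    intro j
    by_contra! h
    obtain ⟨x, hx⟩ := hbij.2 (fun _ => true)
    obtain ⟨y, hy⟩ := hbij.2 (fun _ => false)
    have := eq_of_eqOn_influences (F := fun x : Fin n → Bool => f x j) (x := x) (y := y)
      fun i hi => absurd hi (h i)
    simp [hx, hy] at this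
  choose e he using hex
  have einj : Function.Injective e := fun j j' h => hd (e j) j j' (he j) (h ▸ he j')
  have ebij : Bijective e := Finite.injective_iff_bijective.1 einj
  have hunique : ∀ j i, Influences (fun x : Fin n → Bool => f x j) i → i = e j := fun j i hi => by
    obtain ⟨j', rfl⟩ := ebij.2 i
    rw [hd _ _ _ hi (he j')]
  have hconst : ∀ (x : Fin n → Bool) j, f x j = f (fun _ => x (e j)) j := fun x j =>
    eq_of_eqOn_influences (F := fun x : Fin n → Bool => f x j) fun i hi => by rw [hunique j i hi]
  -- Output `j` is a nonconstant function of the single bit `x (e j)`, hence that bit or its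
  -- negation.
  have hval : ∀ (x : Fin n → Bool) j, f x j = xor (x (e j)) (f (fun _ => false) j) := by
    intro x j
    have hne : f (fun _ => true) j ≠ f (fun _ => false) j := fun h => by
      obtain ⟨z, v, hz⟩ := he j
      have hc : ∀ y : Fin n → Bool, f y j = f (fun _ => false) j := fun y => by
        rw [hconst]
        cases y (e j)
        exacts [rfl, h]
      exact hz ((hc _).trans (hc _).symm)
    rw [hconst]
    revert hne
    cases x (e j) <;> cases f (fun _ => false) j <;> cases f (fun _ => true) j <;> simp
  have hfe : f = permMap (Equiv.ofBijective e ebij) ≫ signMap (f fun _ => false) :=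
    funext fun x => funext fun j => hval x j
  have hperm : monoidalClosure S.IsoGen (permMap (Equiv.ofBijective e ebij)) := by
    cases hS : S.hasSym with
    | true => exact permMap_mem hS _
    | false =>
      have ho : OrderedBlocks (f : (Fin n → Bool) → Fin n → Bool) := orderedBlocks_of_mem hS hf
      have hmono : StrictMono e := fun j j' hj => by
        by_contra! h
        rcases h.lt_or_eq with h | h
        · exact absurd (ho _ _ _ _ (he j') (he j) h) (not_le.2 hj)
        · exact hj.ne' (einj h)
      have hid : e = id := (hmono.range_inj strictMono_id).1
        (by rw [ebij.2.range_eq, Set.range_id])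
      have : permMap (Equiv.ofBijective e ebij) = 𝟙 (Cube.mk n) :=
        funext fun x => funext fun j => congrArg x (congrFun hid j)
      exact this ▸ .id _
  have hsign : monoidalClosure S.IsoGen (signMap (f fun _ => false)) := by
    cases hS : S.hasRev with
    | true => exact signMap_mem hS _
    | false =>
      have hε : ∀ j, f (fun _ => false) j = false := fun j => by
        have := monotone_of_mem hS hf (fun _ => false) (fun _ => true) (fun _ => Bool.false_le _) j
        rw [hval (fun _ => true)] at this
        revert this
        cases f (fun _ => false) j <;> simp
      have : signMap (f fun _ => false) = 𝟙 (Cube.mk n) :=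
        funext fun x => funext fun j => (congrArg _ (hε j)).trans (Bool.xor_false _)
      exact this ▸ .id _
  rw [hfe]
  exact .comp _ _ hperm hsign

theorem dim_le_of_injective {a b : Cube} {f : a.Vertex → b.Vertex} (hf : Function.Injective f) :
    a.dim ≤ b.dim := by
  have := Fintype.card_le_of_injective f hf
  simpa [Nat.pow_le_pow_iff_right] using this

theorem dim_le_of_surjective {a b : Cube} {f : a.Vertex → b.Vertex} (hf : Surjective f) :
    b.dim ≤ a.dim := by
  have := Fintype.card_le_of_surjective f hf
  simpa [Nat.pow_le_pow_iff_right] using this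

theorem isoGen_of_bijective {a b : Cube} {f : a ⟶ b}
    (hf : monoidalClosure (S.MinusGen ⊔ S.PlusGen) f)
    (hbij : Bijective (f : a.Vertex → b.Vertex)) : monoidalClosure S.IsoGen f := by
  have hab := (dim_le_of_injective hbij.1).antisymm (dim_le_of_surjective hbij.2)
  obtain ⟨m⟩ := a
  obtain ⟨n⟩ := b
  obtain rfl : m = n := hab
  exact isoGen_of_bijective_aux hf hbij

theorem isIdentity_of_isoGen (h : S.hasSym = false) (h' : S.hasRev = false) {a b : Cube}
    {f : a ⟶ b} (hf : monoidalClosure S.IsoGen f) : IsIdentity f := by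
  induction hf with
  | of f hf => rcases hf with hf | hf <;> simp_all
  | id a => exact ⟨rfl, rfl⟩
  | comp f g _ _ ihf ihg =>
    obtain ⟨rfl, rfl⟩ := ihf
    obtain ⟨rfl, rfl⟩ := ihg
    exact ⟨rfl, Category.id_comp _⟩
  | tensor f g _ _ ihf ihg =>
    obtain ⟨rfl, rfl⟩ := ihf
    obtain ⟨rfl, rfl⟩ := ihg
    exact ⟨rfl, tensorMap_id _ _⟩

end Isomorphisms

/-! ### Sections of minus maps and retractions of plus maps. -/

section Sections

open Function CubicalSites.Cube

variable {S : Signature}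

theorem exists_section {a b : Cube} {f : a ⟶ b} (hf : monoidalClosure S.MinusGen f) :
    ∃ s : b ⟶ a, monoidalClosure S.PlusGen s ∧ s ≫ f = 𝟙 b := by
  induction hf with
  | of f hf =>
    have hins : ∀ ε, monoidalClosure S.PlusGen (tensorMap (𝟙 (Cube.mk 1)) (faceMap ε)) :=
      fun ε => .tensor _ _ (.id _) (.of _ (.face ε))
    rcases hf with _ | h | h | h | h
    · exact ⟨faceMap false, .of _ (.face _), funext fun x => funext fun i => i.elim0⟩
    -- A connection is split by inserting its neutral element: `true` for the meet, `false` for the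
    -- join.
    · refine ⟨_, hins true, funext fun x => funext fun i => ?_⟩
      obtain rfl : i = 0 := Subsingleton.elim (α := Fin 1) _ _
      exact Bool.and_true _
    · refine ⟨_, hins false, funext fun x => funext fun i => ?_⟩
      obtain rfl : i = 0 := Subsingleton.elim (α := Fin 1) _ _
      exact Bool.or_false _
    · exact ⟨symMap, .of _ (.sym h), symMap_comp_symMap⟩
    · exact ⟨revMap, .of _ (.rev h), revMap_comp_revMap⟩
  | id a => exact ⟨𝟙 a, .id a, Category.id_comp _⟩
  | comp f g _ _ ihf ihg =>
    obtain ⟨f', hf', h1⟩ := ihf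
    obtain ⟨g', hg', h2⟩ := ihg
    exact ⟨g' ≫ f', .comp _ _ hg' hf', by rw [Category.assoc, reassoc_of% h1, h2]⟩
  | tensor f g _ _ ihf ihg =>
    obtain ⟨f', hf', h1⟩ := ihf
    obtain ⟨g', hg', h2⟩ := ihg
    exact ⟨tensorMap f' g', .tensor _ _ hf' hg', by rw [← tensorMap_comp, h1, h2, tensorMap_id]⟩

theorem exists_retraction {a b : Cube} {f : a ⟶ b} (hf : monoidalClosure S.PlusGen f) :
    ∃ t : b ⟶ a, monoidalClosure S.MinusGen t ∧ f ≫ t = 𝟙 a := by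
  induction hf with
  | of f hf =>
    rcases hf with ε | h | h
    · exact ⟨projMap, .of _ .proj, funext fun x => funext fun i => i.elim0⟩
    · exact ⟨symMap, .of _ (.sym h), symMap_comp_symMap⟩
    · exact ⟨revMap, .of _ (.rev h), revMap_comp_revMap⟩
  | id a => exact ⟨𝟙 a, .id a, Category.id_comp _⟩
  | comp f g _ _ ihf ihg =>
    obtain ⟨f', hf', h1⟩ := ihf
    obtain ⟨g', hg', h2⟩ := ihg
    exact ⟨g' ≫ f', .comp _ _ hg' hf', by rw [Category.assoc, reassoc_of% h2, h1]⟩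
  | tensor f g _ _ ihf ihg =>
    obtain ⟨f', hf', h1⟩ := ihf
    obtain ⟨g', hg', h2⟩ := ihg
    exact ⟨tensorMap f' g', .tensor _ _ hf' hg', by rw [← tensorMap_comp, h1, h2, tensorMap_id]⟩

theorem surjective_of_minus {a b : Cube} {f : a ⟶ b} (hf : monoidalClosure S.MinusGen f) :
    Surjective (f : a.Vertex → b.Vertex) := by
  obtain ⟨s, -, hs⟩ := exists_section hf
  exact fun y => ⟨s y, congrFun hs y⟩

theorem injective_of_plus {a b : Cube} {f : a ⟶ b} (hf : monoidalClosure S.PlusGen f) :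
    Function.Injective (f : a.Vertex → b.Vertex) := by
  obtain ⟨t, -, ht⟩ := exists_retraction hf
  exact LeftInverse.injective (g := t) fun x => congrFun ht x

end Sections
-- Plus maps as subcubes.
section Subcubes

open Function CubicalSites.Cube

variable {S : Signature}

theorem exists_image_subcube {a b : Cube} {f : a ⟶ b} (hf : monoidalClosure S.PlusGen f) :
    ∀ φ : Fin a.dim → Set Bool, ∃ ψ : Fin b.dim → Set Bool,
      (f : a.Vertex → b.Vertex) '' Set.univ.pi φ = Set.univ.pi ψ := by
  induction hf with
  | of f hf =>
    rcases hf with ε | h | h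
    · refine fun φ => ⟨fun _ => {ε}, Set.ext fun y => ⟨?_, fun hy => ?_⟩⟩
      · rintro ⟨x, -, rfl⟩ i -
        rfl
      · exact ⟨fun i => i.elim0, fun i => i.elim0, funext fun i => (hy i trivial).symm⟩
    · refine fun φ => ⟨fun i : Fin 2 => φ (![1, 0] i), Set.ext fun y => ⟨?_, fun hy => ?_⟩⟩
      · rintro ⟨x, hx, rfl⟩ i -
        change Fin 2 at i
        fin_cases i
        exacts [hx (1 : Fin 2) trivial, hx (0 : Fin 2) trivial]
      · refine ⟨symMap y, fun i _ => ?_, congrFun symMap_comp_symMap y⟩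
        change Fin 2 at i
        fin_cases i
        exacts [hy (1 : Fin 2) trivial, hy (0 : Fin 2) trivial]
    · refine fun φ => ⟨fun i => {e | (!e) ∈ φ i}, Set.ext fun y => ⟨?_, fun hy => ?_⟩⟩
      · rintro ⟨x, hx, rfl⟩ i -
        obtain rfl : i = 0 := Subsingleton.elim (α := Fin 1) _ _
        have := hx 0 trivial
        rwa [← Bool.not_not (x 0)] at this
      · refine ⟨revMap y, fun i _ => ?_, congrFun revMap_comp_revMap y⟩
        obtain rfl : i = 0 := Subsingleton.elim (α := Fin 1) _ _
        exact hy 0 trivial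
  | id a => exact fun φ => ⟨φ, Set.image_id _⟩
  | comp f g _ _ ihf ihg =>
    intro φ
    obtain ⟨ψ, hψ⟩ := ihf φ
    obtain ⟨χ, hχ⟩ := ihg ψ
    exact ⟨χ, by rw [← hχ, ← hψ, Set.image_image]; rfl⟩
  | tensor f g _ _ ihf ihg =>
    intro φ
    obtain ⟨ψ, hψ⟩ := ihf fun i => φ (Fin.castAdd _ i)
    obtain ⟨χ, hχ⟩ := ihg fun i => φ (Fin.natAdd _ i)
    exact ⟨_, image_appendMap f g φ hψ hχ⟩

theorem exists_range_eq_subcube {a b : Cube} {f : a ⟶ b} (hf : monoidalClosure S.PlusGen f) :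
    ∃ ψ : Fin b.dim → Set Bool,
      Set.range (f : a.Vertex → b.Vertex) = Set.univ.pi ψ := by
  obtain ⟨ψ, hψ⟩ := exists_image_subcube hf fun _ => Set.univ
  exact ⟨ψ, by rw [← hψ, Set.pi_univ, Set.image_univ]⟩

/-- The basic morphisms to the interval in the plus class. -/
inductive FaceOrId : ∀ {a : Cube}, (a ⟶ Cube.mk 1) → Prop
  | face (ε : Bool) : FaceOrId (faceMap ε)
  | id : FaceOrId (𝟙 (Cube.mk 1))

theorem FaceOrId.plus {a : Cube} {f : a ⟶ Cube.mk 1} (hf : FaceOrId f) :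
    monoidalClosure S.PlusGen f := by
  cases hf with
  | face ε => exact .of _ (.face ε)
  | id => exact .id _

theorem exists_faceOrId (φ : Fin 1 → Set Bool) (hφ : ∀ i, (φ i).Nonempty) :
    ∃ (a : Cube) (f : a ⟶ Cube.mk 1), FaceOrId f ∧
      Set.range (f : a.Vertex → (Cube.mk 1).Vertex) = Set.univ.pi φ := by
  have hpi : ∀ y : Fin 1 → Bool, y 0 ∈ φ 0 → y ∈ Set.univ.pi φ := fun y hy i _ => by
    rwa [Subsingleton.elim i 0]
  by_cases h : φ 0 = Set.univ
  · exact ⟨_, _, .id, Set.Subset.antisymm (fun y _ => hpi y (h ▸ trivial)) fun y _ => ⟨y, rfl⟩⟩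
  · obtain ⟨ε, hε⟩ := hφ 0
    refine ⟨_, _, .face ε, Set.Subset.antisymm ?_ fun y hy => ?_⟩
    · rintro _ ⟨x, rfl⟩
      exact hpi _ hε
    · refine ⟨fun i => i.elim0, funext fun i => ?_⟩
      obtain rfl : i = 0 := Subsingleton.elim (α := Fin 1) _ _
      by_contra hne
      have hy0 : y 0 ∈ φ 0 := hy 0 trivial
      have hne' : ε ≠ y 0 := hne
      refine h (Set.eq_univ_of_forall fun b => ?_)
      generalize y 0 = e at *
      rcases eq_or_ne b ε with rfl | hb
      · exact hε
      · have : b = e := by revert hb hne'; cases b <;> cases ε <;> cases e <;> simp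
        exact this ▸ hy0

/-- Every nonempty subcube is the image of a morphism of the plus class. -/
theorem exists_plus_of_subcube (S : Signature) : ∀ {n : ℕ} (ψ : Fin n → Set Bool),
    (∀ i, (ψ i).Nonempty) → ∃ (a : Cube) (f : a ⟶ Cube.mk n), monoidalClosure S.PlusGen f ∧
      Set.range (f : a.Vertex → (Cube.mk n).Vertex) = Set.univ.pi ψ
  | 0, ψ, _ => ⟨_, 𝟙 _, .id _, Set.Subset.antisymm (fun _ _ i => i.elim0) fun y _ => ⟨y, rfl⟩⟩
  | n + 1, ψ, h => by
    obtain ⟨a, f, hf, hfψ⟩ := exists_plus_of_subcube S (fun i : Fin n => ψ (Fin.castAdd 1 i))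
      fun i => h _
    obtain ⟨a', g, hg, hgψ⟩ := exists_faceOrId (fun i : Fin 1 => ψ (Fin.natAdd n i))
      fun i => h _
    refine ⟨a.tensor a', tensorMap f g, .tensor _ _ hf hg.plus, ?_⟩
    have := image_appendMap f g (fun _ => Set.univ) (by rw [Set.pi_univ, Set.image_univ, hfψ])
      (by rw [Set.pi_univ, Set.image_univ, hgψ])
    rw [Set.pi_univ, Set.image_univ] at this
    refine this.trans ?_
    congr 1
    exact Fin.append_castAdd_natAdd

/-- Compose `f` with a retraction of `g`. Equality of images makes the result bijective, hence an
isomorphism. -/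
theorem exists_isoGen_comp_eq {a a' b : Cube} {f : a ⟶ b} {g : a' ⟶ b}
    (hf : monoidalClosure S.PlusGen f) (hg : monoidalClosure S.PlusGen g)
    (h : Set.range (f : a.Vertex → b.Vertex) = Set.range (g : a'.Vertex → b.Vertex)) :
    ∃ w : a ⟶ a', monoidalClosure S.IsoGen w ∧ w ≫ g = f := by
  obtain ⟨t, ht, hgt⟩ := exists_retraction hg
  have hw : (f ≫ t) ≫ g = f := funext fun x => by
    obtain ⟨y, hy⟩ : f x ∈ Set.range (g : a'.Vertex → b.Vertex) := h ▸ ⟨x, rfl⟩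
    have : t (g y) = y := congrFun hgt y
    rw [Cube.comp_apply, Cube.comp_apply, ← hy, this]
  refine ⟨f ≫ t, isoGen_of_bijective (.comp _ _ (plus_le_site hf) (minus_le_site ht)) ⟨?_, ?_⟩, hw⟩
  · refine Function.Injective.of_comp (f := g) ?_
    have := injective_of_plus hf
    rwa [← hw] at this
  · intro y
    obtain ⟨x, hx⟩ : g y ∈ Set.range (f : a.Vertex → b.Vertex) := h ▸ ⟨y, rfl⟩
    exact ⟨x, (congrArg t hx).trans (congrFun hgt y)⟩

/-- A morphism of the plus class to a tensor product is, up to isomorphism, a tensor product. -/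
theorem exists_tensor_of_plus {a b b' : Cube} {f : a ⟶ b.tensor b'}
    (hf : monoidalClosure S.PlusGen f) : ∃ (c c' : Cube) (g : c ⟶ b) (g' : c' ⟶ b')
      (w : a ⟶ c.tensor c'), monoidalClosure S.PlusGen g ∧ monoidalClosure S.PlusGen g' ∧
      monoidalClosure S.IsoGen w ∧ w ≫ tensorMap g g' = f := by
  obtain ⟨ψ, hψ⟩ := exists_range_eq_subcube hf
  have hne : ∀ i, (ψ i).Nonempty := fun i => by
    have : f (fun _ => false) ∈ Set.univ.pi ψ := hψ ▸ ⟨_, rfl⟩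
    exact ⟨_, this i trivial⟩
  obtain ⟨c, g, hg, hgψ⟩ := exists_plus_of_subcube S
    (fun i : Fin b.dim => ψ (Fin.castAdd b'.dim i)) fun i => hne _
  obtain ⟨c', g', hg', hgψ'⟩ := exists_plus_of_subcube S
    (fun i : Fin b'.dim => ψ (Fin.natAdd b.dim i)) fun i => hne _
  have h1 := image_appendMap g g' (fun _ => Set.univ) (by rw [Set.pi_univ, Set.image_univ, hgψ])
      (by rw [Set.pi_univ, Set.image_univ, hgψ'])
  rw [Set.pi_univ, Set.image_univ] at h1
  have h2 : Set.range (f : a.Vertex → (b.tensor b').Vertex) = Set.range (appendMap g g') := by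
    rw [h1, hψ]
    congr 1
    exact Fin.append_castAdd_natAdd.symm
  obtain ⟨w, hw, hwf⟩ := exists_isoGen_comp_eq hf
    (.tensor (b := b) (b' := b') g g' hg hg') h2
  exact ⟨c, c', g, g', w, hg, hg', hw, hwf⟩

theorem exists_faceOrId_of_plus {a : Cube} {f : a ⟶ Cube.mk 1}
    (hf : monoidalClosure S.PlusGen f) : ∃ (c : Cube) (g : c ⟶ Cube.mk 1) (w : a ⟶ c),
      FaceOrId g ∧ monoidalClosure S.IsoGen w ∧ w ≫ g = f := by
  obtain ⟨ψ, hψ⟩ := exists_range_eq_subcube hf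
  obtain ⟨c, g, hg, hgψ⟩ := exists_faceOrId ψ fun i => by
    have : f (fun _ => false) ∈ Set.univ.pi ψ := hψ ▸ ⟨_, rfl⟩
    exact ⟨_, this i trivial⟩
  obtain ⟨w, hw, hwf⟩ := exists_isoGen_comp_eq hf hg.plus (hψ.trans hgψ.symm)
  exact ⟨c, g, w, hg, hw, hwf⟩

end Subcubes

/-! ### Moving plus maps past minus maps. -/

section Factorization

open Function CubicalSites.Cube

variable {S : Signature}

/-- `f` is a morphism of the minus class followed by one of the plus class. -/
def Signature.Factors (S : Signature) {a b : Cube} (f : a ⟶ b) : Prop :=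
  ∃ (c : Cube) (l : a ⟶ c) (r : c ⟶ b),
    monoidalClosure S.MinusGen l ∧ monoidalClosure S.PlusGen r ∧ l ≫ r = f

namespace Signature.Factors

theorem of_minus {a b : Cube} {f : a ⟶ b} (hf : monoidalClosure S.MinusGen f) : S.Factors f :=
  ⟨_, f, 𝟙 _, hf, .id _, Category.comp_id _⟩

theorem of_plus {a b : Cube} {f : a ⟶ b} (hf : monoidalClosure S.PlusGen f) : S.Factors f :=
  ⟨_, 𝟙 _, f, .id _, hf, Category.id_comp _⟩

theorem of_eq {a b : Cube} {f g : a ⟶ b} (h : f = g) (hg : S.Factors g) : S.Factors f := h ▸ hg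

theorem minus_comp {a b c : Cube} {f : a ⟶ b} {g : b ⟶ c} (hf : monoidalClosure S.MinusGen f)
    (hg : S.Factors g) : S.Factors (f ≫ g) := by
  obtain ⟨d, l, r, hl, hr, rfl⟩ := hg
  exact ⟨d, f ≫ l, r, .comp _ _ hf hl, hr, Category.assoc _ _ _⟩

theorem comp_plus {a b c : Cube} {f : a ⟶ b} {g : b ⟶ c} (hf : S.Factors f)
    (hg : monoidalClosure S.PlusGen g) : S.Factors (f ≫ g) := by
  obtain ⟨d, l, r, hl, hr, rfl⟩ := hf
  exact ⟨d, l, r ≫ g, hl, .comp _ _ hr hg, (Category.assoc _ _ _).symm⟩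

theorem tensor {a b a' b' : Cube} {f : a ⟶ b} {g : a' ⟶ b'} (hf : S.Factors f)
    (hg : S.Factors g) : S.Factors (tensorMap f g) := by
  obtain ⟨d, l, r, hl, hr, rfl⟩ := hf
  obtain ⟨d', l', r', hl', hr', rfl⟩ := hg
  exact ⟨_, tensorMap l l', tensorMap r r', .tensor _ _ hl hl', .tensor _ _ hr hr',
    (tensorMap_comp _ _ _ _).symm⟩

/-- A binary operation on the interval with a neutral and an absorbing element, restricted to
a face of the square. -/
theorem faceOrId_comp {m : Cube.mk 2 ⟶ Cube.mk 1} (hm : monoidalClosure S.MinusGen m)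
    {e : Bool} {op : Bool → Bool → Bool} (hop : ∀ x i, m x i = op (x (0 : Fin 2)) (x (1 : Fin 2)))
    (he : ∀ y, op e y = y) (he' : ∀ y, op y e = y) (h : ∀ y, op (!e) y = !e)
    (h' : ∀ y, op y (!e) = !e) {c c' : Cube} {p : c ⟶ Cube.mk 1} {q : c' ⟶ Cube.mk 1}
    (hp : FaceOrId p) (hq : FaceOrId q) : S.Factors (tensorMap p q ≫ m) := by
  cases hp with
  | face ε =>
    cases hq with
    | face δ =>
      have : tensorMap (faceMap ε) (faceMap δ) ≫ m = faceMap (op ε δ) :=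
        funext fun x => funext fun i => hop _ _
      exact this ▸ of_plus (.of _ (.face _))
    | id =>
      -- Restricting to the face of the neutral element gives the identity; restricting to that of
      -- the absorbing element gives a constant map, that is, the projection followed by a face.
      rcases Bool.eq_or_eq_not ε e with rfl | rfl
      · have : tensorMap (faceMap ε) (𝟙 (Cube.mk 1)) ≫ m = 𝟙 (Cube.mk 1) := by
          funext x i
          obtain rfl : i = 0 := Subsingleton.elim (α := Fin 1) _ _
          exact (hop _ _).trans (he _)
        exact of_eq (a := Cube.mk 1) this (of_minus (.id _))
      · have : tensorMap (faceMap !e) (𝟙 (Cube.mk 1)) ≫ m = projMap ≫ faceMap !e :=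
          funext fun x => funext fun i => (hop _ _).trans (h _)
        exact this ▸ ⟨_, projMap, faceMap _, .of _ .proj, .of _ (.face _), rfl⟩
  | id =>
    cases hq with
    | face ε =>
      rcases Bool.eq_or_eq_not ε e with rfl | rfl
      · have : tensorMap (𝟙 (Cube.mk 1)) (faceMap ε) ≫ m = 𝟙 (Cube.mk 1) := by
          funext x i
          obtain rfl : i = 0 := Subsingleton.elim (α := Fin 1) _ _
          exact (hop _ _).trans (he' _)
        exact of_eq (a := Cube.mk 1) this (of_minus (.id _))
      · have : tensorMap (𝟙 (Cube.mk 1)) (faceMap !e) ≫ m = projMap ≫ faceMap !e :=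
          funext fun x => funext fun i => (hop _ _).trans (h' _)
        exact this ▸ ⟨_, projMap, faceMap _, .of _ .proj, .of _ (.face _), rfl⟩
    | id => exact of_minus (.comp _ _ (.tensor _ _ (.id _) (.id _)) hm)

theorem plus_comp_of_faceOrId {m : Cube.mk 2 ⟶ Cube.mk 1}
    (hm : ∀ {c c' : Cube} {p : c ⟶ Cube.mk 1} {q : c' ⟶ Cube.mk 1}, FaceOrId p → FaceOrId q →
      S.Factors (tensorMap p q ≫ m)) {a : Cube} {f : a ⟶ Cube.mk 2}
    (hf : monoidalClosure S.PlusGen f) : S.Factors (f ≫ m) := by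
  obtain ⟨c, c', g, g', w, hg, hg', hw, hwf⟩ :=
    exists_tensor_of_plus (b := Cube.mk 1) (b' := Cube.mk 1) hf
  obtain ⟨d, p, v, hp, hv, rfl⟩ := exists_faceOrId_of_plus hg
  obtain ⟨d', p', v', hp', hv', rfl⟩ := exists_faceOrId_of_plus hg'
  have : f ≫ m = (w ≫ tensorMap v v') ≫ (tensorMap p p' ≫ m) := by
    rw [← hwf, tensorMap_comp]
    rfl
  rw [this]
  exact minus_comp (.comp _ _ (isoGen_le_minus hw)
    (.tensor _ _ (isoGen_le_minus hv) (isoGen_le_minus hv'))) (hm hp hp')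

/-- The induction is on the minus map, with the plus map arbitrary: for composites the plus part
left by the first factor is passed to the second, and for tensor products `exists_tensor_of_plus`
splits the plus map. -/
theorem plus_comp_minus {b c : Cube} {g : b ⟶ c} (hg : monoidalClosure S.MinusGen g) :
    ∀ {a : Cube} {f : a ⟶ b}, monoidalClosure S.PlusGen f → S.Factors (f ≫ g) := by
  induction hg with
  | of g hg =>
    intro a f hf
    have hg' := monoidalClosure.of g hg
    rcases hg with _ | h | h | h | h
    · obtain ⟨c, p, w, hp, hw, rfl⟩ := exists_faceOrId_of_plus hf
      rw [Category.assoc]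
      refine minus_comp (isoGen_le_minus hw) ?_
      cases hp with
      | face ε =>
        have : faceMap ε ≫ projMap = 𝟙 (Cube.mk 0) := funext fun x => funext fun i => i.elim0
        exact this ▸ of_minus (.id _)
      | id => exact of_minus (.of _ .proj)
    · exact plus_comp_of_faceOrId (faceOrId_comp hg' (e := true) (op := and) (fun _ _ => rfl)
        (by decide) (by decide) (by decide) (by decide)) hf
    · exact plus_comp_of_faceOrId (faceOrId_comp hg' (e := false) (op := or) (fun _ _ => rfl)
        (by decide) (by decide) (by decide) (by decide)) hf
    · exact of_plus (.comp _ _ hf (.of _ (.sym h)))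
    · exact of_plus (.comp _ _ hf (.of _ (.rev h)))
  | id b =>
    intro a f hf
    exact of_plus (.comp _ _ hf (.id _))
  | comp g g' _ _ ih ih' =>
    intro a f hf
    obtain ⟨d, l, r, hl, hr, hlr⟩ := ih hf
    rw [← Category.assoc, ← hlr, Category.assoc]
    exact minus_comp hl (ih' hr)
  | tensor g g' _ _ ih ih' =>
    intro a f hf
    obtain ⟨c, c', p, p', w, hp, hp', hw, rfl⟩ := exists_tensor_of_plus hf
    rw [Category.assoc, ← tensorMap_comp]
    exact minus_comp (isoGen_le_minus hw) ((ih hp).tensor (ih' hp'))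

theorem of_site {a b : Cube} {f : a ⟶ b} (hf : monoidalClosure (S.MinusGen ⊔ S.PlusGen) f) :
    S.Factors f := by
  induction hf with
  | of f hf =>
    rcases hf with hf | hf
    · exact of_minus (.of _ hf)
    · exact of_plus (.of _ hf)
  | id a => exact of_minus (.id a)
  | comp f g _ _ ihf ihg =>
    obtain ⟨c, l, r, hl, hr, rfl⟩ := ihf
    obtain ⟨c', l', r', hl', hr', rfl⟩ := ihg
    have : (l ≫ r) ≫ l' ≫ r' = l ≫ (r ≫ l') ≫ r' := rfl
    rw [this]
    exact minus_comp hl ((plus_comp_minus hl' hr).comp_plus hr')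
  | tensor f g _ _ ihf ihg => exact ihf.tensor ihg

end Signature.Factors

end Factorization

/-! ### The Reedy structures on the site. -/

namespace Site

open Function CubicalSites.Cube

variable {S : Signature}

theorem isIso_of_isoGen {a b : Site S} {f : a ⟶ b} (hf : monoidalClosure S.IsoGen f.hom) :
    IsIso f := by
  obtain ⟨g, hg, h1, h2⟩ := exists_inverse_of_isoGen hf
  exact ⟨⟨g, minus_le_site (isoGen_le_minus hg)⟩, WideSubcategory.hom_ext _ h1,
    WideSubcategory.hom_ext _ h2⟩

theorem bijective_of_isIso {a b : Site S} (f : a ⟶ b) [IsIso f] :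
    Bijective (f.hom : a.obj.Vertex → b.obj.Vertex) := by
  have h1 : f.hom ≫ (inv f).hom = 𝟙 _ :=
    congrArg InducedWideCategory.Hom.hom (IsIso.hom_inv_id f)
  have h2 : (inv f).hom ≫ f.hom = 𝟙 _ :=
    congrArg InducedWideCategory.Hom.hom (IsIso.inv_hom_id f)
  exact bijective_iff_has_inverse.2 ⟨(inv f).hom, fun x => congrFun h1 x, fun x => congrFun h2 x⟩

theorem isoGen_of_isIso {a b : Site S} (f : a ⟶ b) [IsIso f] :
    monoidalClosure S.IsoGen f.hom := isoGen_of_bijective f.property (bijective_of_isIso f)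

theorem isIso_iff_bijective {a b : Site S} {f : a ⟶ b} :
    IsIso f ↔ Bijective (f.hom : a.obj.Vertex → b.obj.Vertex) :=
  ⟨fun _ => bijective_of_isIso f, fun h => isIso_of_isoGen (isoGen_of_bijective f.property h)⟩

theorem isSplitEpi_of_minus {a b : Site S} (f : a ⟶ b) (hf : minus S f) : IsSplitEpi f := by
  obtain ⟨s, hs, h⟩ := exists_section hf
  exact ⟨⟨⟨s, plus_le_site hs⟩, WideSubcategory.hom_ext _ h⟩⟩

theorem mono_of_plus {a b : Site S} (f : a ⟶ b) (hf : plus S f) : Mono f := by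
  obtain ⟨t, ht, h⟩ := exists_retraction hf
  have : IsSplitMono f := ⟨⟨⟨t, minus_le_site ht⟩, WideSubcategory.hom_ext _ h⟩⟩
  infer_instance

theorem isGeneralizedReedy (S : Signature) :
    IsGeneralizedReedy (deg S) (minus S) (plus S) where
  toIsOrthogonalFactorizationSystem := .of_splitEpi_of_mono
    (fun a b f _ => isoGen_le_minus (isoGen_of_isIso f))
    (fun a b f _ => isoGen_le_plus (isoGen_of_isIso f))
    (fun a b c f g hf hg => .comp _ _ hf hg)
    (fun a b c f g hf hg => .comp _ _ hf hg)
    (fun a b f => by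
      obtain ⟨c, l, r, hl, hr, h⟩ := Signature.Factors.of_site f.property
      exact ⟨⟨c⟩, ⟨l, minus_le_site hl⟩, ⟨r, plus_le_site hr⟩, hl, hr,
        WideSubcategory.hom_ext _ h⟩)
    (fun a b f hf => isSplitEpi_of_minus f hf) (fun a b f hf => mono_of_plus f hf)
  essentiallySmall := inferInstance
  deg_iso a b := fun ⟨e⟩ =>
    have := bijective_of_isIso e.hom
    (dim_le_of_injective this.1).antisymm (dim_le_of_surjective this.2)
  deg_minus a b f hf h := by
    have hs := surjective_of_minus hf
    -- A surjection between cubes of equal dimension is bijective, hence an isomorphism of the site.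
    refine (dim_le_of_surjective hs).lt_of_ne fun hd => h (isIso_iff_bijective.2 ?_)
    exact (Fintype.bijective_iff_surjective_and_card _).2 ⟨hs, by simp [hd]⟩
  deg_plus a b f hf h := by
    have hi := injective_of_plus hf
    refine (dim_le_of_injective hi).lt_of_ne fun hd => h (isIso_iff_bijective.2 ?_)
    exact (Fintype.bijective_iff_injective_and_card _).2 ⟨hi, by simp [hd]⟩

/-- Bijectivity on subcubes is detected by pseudo-sections. -/
theorem bijOn_of_isPseudoSection {a b b' : Site S} {p : a ⟶ b} {p' : a ⟶ b'}
    (h : ∀ ⦃c : Site S⦄ (i : c ⟶ a), IsPseudoSection p i → IsPseudoSection p' i)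
    (ψ : Fin a.obj.dim → Set Bool) (hψ : ∀ i, (ψ i).Nonempty)
    (hp : Set.BijOn (p.hom : a.obj.Vertex → b.obj.Vertex) (Set.univ.pi ψ) Set.univ) :
    Set.BijOn (p'.hom : a.obj.Vertex → b'.obj.Vertex) (Set.univ.pi ψ) Set.univ := by
  obtain ⟨c, r, hr, hrψ⟩ := exists_plus_of_subcube S ψ hψ
  have hinj := injective_of_plus hr
  have key : ∀ {d : Site S} (q : a ⟶ d),
      IsPseudoSection q (⟨r, plus_le_site hr⟩ : (⟨c⟩ : Site S) ⟶ a) ↔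
        Set.BijOn (q.hom : a.obj.Vertex → d.obj.Vertex) (Set.univ.pi ψ) Set.univ := by
    intro d q
    have hr' : Set.BijOn (r : c.Vertex → a.obj.Vertex) Set.univ (Set.univ.pi ψ) := by
      rw [← hrψ, ← Set.image_univ]
      exact hinj.injOn.bijOn_image
    unfold IsPseudoSection
    rw [isIso_iff_bijective, ← Set.bijOn_univ, ← hr'.image_eq]
    exact Set.bijOn_comp_iff hr'.injOn
  exact (key p').1 (h _ ((key p).2 hp))

/-- A section `s'` of `p` in the plus class is a pseudo-section of `p'`. Following `p'` by the
inverse of `s' ≫ p'` makes `s'` a common section, without changing which subcubes are carried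
bijectively. -/
theorem pseudoEqual_of_minus {a b b' : Site S} {p : a ⟶ b} {p' : a ⟶ b'} (hp : minus S p)
    (h : ∀ ⦃c : Site S⦄ (i : c ⟶ a), IsPseudoSection p i ↔ IsPseudoSection p' i) :
    PseudoEqual p p' := by
  obtain ⟨s, hs, hsp⟩ := exists_section hp
  let s' : b ⟶ a := ⟨s, plus_le_site hs⟩
  have hs'p : s' ≫ p = 𝟙 b := WideSubcategory.hom_ext _ hsp
  have hw : IsIso (s' ≫ p') := (h s').1 (by unfold IsPseudoSection; rw [hs'p]; infer_instance)
  obtain ⟨ψ, hψ⟩ := exists_range_eq_subcube hs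
  have hg : s' ≫ p' ≫ inv (s' ≫ p') = 𝟙 b := by rw [← Category.assoc, IsIso.hom_inv_id]
  have hbij := bijective_of_isIso (inv (s' ≫ p'))
  have hbij' : ∀ φ : Fin a.obj.dim → Set Bool,
      Set.BijOn ((p' ≫ inv (s' ≫ p')).hom : a.obj.Vertex → b.obj.Vertex) (Set.univ.pi φ) Set.univ ↔
      Set.BijOn (p'.hom : a.obj.Vertex → b'.obj.Vertex) (Set.univ.pi φ) Set.univ := by
    refine fun φ => ⟨fun hφ => ?_, fun hφ => (Set.bijOn_univ.2 hbij).comp hφ⟩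
    have h1 := (Set.bijOn_univ.2 (bijective_of_isIso (s' ≫ p'))).comp hφ
    have h2 : (p' ≫ inv (s' ≫ p')) ≫ s' ≫ p' = p' := by simp
    exact (congrArg InducedWideCategory.Hom.hom h2) ▸ h1
  have key : p.hom = (p' ≫ inv (s' ≫ p')).hom :=
    eq_of_bijOn_iff_bijOn (f := p.hom) (g := (p' ≫ inv (s' ≫ p')).hom)
      (noDiagonals_of_mem p.property) (noDiagonals_of_mem (p' ≫ inv (s' ≫ p')).property)
      (s := s) (fun v => congrFun hsp v)
      (fun v => congrFun (congrArg InducedWideCategory.Hom.hom hg) v) hψ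
      (fun φ hφ => (show Set.BijOn _ _ _ ↔ _ from
        ⟨bijOn_of_isPseudoSection (fun c i => (h i).1) φ hφ,
          bijOn_of_isPseudoSection (fun c i => (h i).2) φ hφ⟩).trans (hbij' φ).symm)
  refine ⟨asIso (s' ≫ p'), ?_⟩
  rw [WideSubcategory.hom_ext _ key]
  simp

theorem isStronglySkeletal (S : Signature) :
    IsStronglySkeletal (deg S) (minus S) (plus S) where
  toIsGeneralizedReedy := isGeneralizedReedy S
  isSplitEpi _ _ p hp := isSplitEpi_of_minus p hp
  pseudoEqual _ _ _ _ _ hp _ h := pseudoEqual_of_minus hp h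

theorem isIdentity_of_isIso (h : S.hasSym = false) (h' : S.hasRev = false) {a b : Site S}
    (f : a ⟶ b) [IsIso f] : IsIdentity f := by
  obtain ⟨a⟩ := a
  obtain ⟨b⟩ := b
  obtain ⟨hab, hf⟩ := isIdentity_of_isoGen h h' (isoGen_of_isIso f)
  obtain rfl : a = b := hab
  exact ⟨rfl, WideSubcategory.hom_ext _ hf⟩

end Site

end CubicalSites

theorem mainTheorem1 (S : CubicalSites.Signature) :
    CubicalSites.IsStronglySkeletal
        (CubicalSites.Site.deg S) (CubicalSites.Site.minus S) (CubicalSites.Site.plus S) ∧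
      CubicalSites.IsEilenbergZilber.{w', w}
        (CubicalSites.Site.deg S) (CubicalSites.Site.minus S) (CubicalSites.Site.plus S) ∧
      (S.hasSym = false → S.hasRev = false →
        CubicalSites.IsRegularSkeletalReedy
          (CubicalSites.Site.deg S) (CubicalSites.Site.minus S) (CubicalSites.Site.plus S)) :=
  ⟨CubicalSites.Site.isStronglySkeletal S, (CubicalSites.Site.isStronglySkeletal S).isEilenbergZilber,
    fun h h' => (CubicalSites.Site.isStronglySkeletal S).isRegularSkeletalReedy
      (fun _ _ f _ => CubicalSites.Site.isIdentity_of_isIso h h' f)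
      fun _ _ f hf => CubicalSites.Site.mono_of_plus f hf⟩
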